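/- Let $T\ge 2$ and consider a $T$-node discrete memoryless multiple-relay channel: finite input alphabets $\mathcal X_1,\dots,\mathcal X_{T-1}$, finite output alphabets $\mathcal Y_2,\dots,\mathcal Y_T$, and a channel law $p^*(y_2,\dots,y_T\mid x_1,\dots,x_{T-1})$, applied independently in each channel use. Node $1$ is the source, node $T$ the destination, nodes $2,\dots,T-1$ are relays. An $(M,N)$ code consists of an encoder $\{1,\dots,M\}\to\mathcal X_1^N$ at the source, maps $\mathcal Y_t^{i-1}\to\mathcal X_t$ ($1\le i\le N$) at each relay $t$, and a decoder $\mathcal Y_T^N\to\{1,\dots,M\}$; its rate is $\frac1N\log_2 M$, and its error probability is $\Pr\{\hat W\ne W\}$ for a uniformly distributed message $W$. The code is a two-hop myopic decode-forward code if, for some $m\ge 1$ and $n,B\ge 1$ and some permutation $\pi$ of the relays, extended by $\pi(t)=t$ for $t\in\{0,1,T,T+1\}$, it has the following form. The message consists of $B$ sub-messages $w_1,\dots,w_B\in\{1,\dots,m\}$ (so $M=m^B$), and $w_j$ is a fixed dummy for $j\le 0$ and $j>B$. It is sent in $B+T-2$ blocks of $n$ channel uses ($N=n(B+T-2)$). In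 block $b$ the node $\pi(t)$, $1\le t\le T-1$, sends a function (which may depend on the node and on $b$) of its estimates of $w_{b-t+1}$ and $w_{b-t}$ only, i.e. of the sub-messages it decoded at the ends of the blocks $b-1$ and $b-2$ (for the source: of $w_b$ and $w_{b-1}$). At the end of block $b$ the node $\pi(t)$, $2\le t\le T$, decodes $w_{b-t+2}$ as the unique common element of two lists of candidates: one formed at the end of block $b$ from the signal received in block $b$ and its estimates of $w_{b-t+1},w_{b-t}$, the other formed at the end of block $b-1$ from the signal received in block $b-1$ and its estimates of $w_{b-t+1},w_{b-t},w_{b-t-1}$ (if $t=2$, only the first list is used). If there is no unique common element, the estimate is the dummy. The destination outputs its estimates of $w_1,\dots,w_B$. A rate $R$ is achievable using two-hop myopic decode-forward if for all $\delta,\epsilon>0$ there is a two-hop myopic decode-forward code of rate at least $R-\delta$ whose error probability is less than $\epsilon$ and for which also the probability that some relay or the destination decodes some sub-message wrongly is less than $\epsilon$. Then every real $R$ with $$R\le R_{2\text{-hop}}=\sup_{\pi}\,\sup_{p}\,\min_{t\in\{2,\dots,T\}} I\big(U_{\pi(t-2)},U_{\pi(t-1)};Y_{\pi(t)}\,\big|\,U_{\pi(t)},U_{\pi(t+1)}\big)$$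 is achievable using two-hop myopic decode-forward. Here mutual information is in bits, $U_{\pi(0)}=U_{\pi(T)}=U_{\pi(T+1)}=0$, the outer supremum is over all permutations $\pi$ of the relays $\{2,\dots,T-1\}$, extended as above, and the inner one is over all finite alphabets of $U_1,\dots,U_{T-1}$ and all joint distributions of the form $$p(u_{\pi(1)})\cdots p(u_{\pi(T-1)})\;p(x_{\pi(1)}|u_{\pi(1)},u_{\pi(2)})\cdots p(x_{\pi(T-2)}|u_{\pi(T-2)},u_{\pi(T-1)})\,p(x_{\pi(T-1)}|u_{\pi(T-1)})\;p^*(y_2,\dots,y_T|x_1,\dots,x_{T-1}).$$ -/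

import Mathlib

/-! ## Nodes

The nodes of the network are labelled `1, …, T`; node `1` is the source, node `T` is the
destination, nodes `2, …, T - 1` are the relays. -/

/-- The transmitting nodes `1, …, T - 1`. -/
abbrev Tx (T : ℕ) : Type := ↥(Finset.Icc 1 (T - 1))

/-- The receiving nodes `2, …, T`. -/
abbrev Rx (T : ℕ) : Type := ↥(Finset.Icc 2 T)

/-- The relays `2, …, T - 1`. -/
abbrev Relay (T : ℕ) : Type := ↥(Finset.Icc 2 (T - 1))

/-- The source, as a transmitter. -/
def srcTx {T : ℕ} (hT : 2 ≤ T) : Tx T := ⟨1, by rw [Finset.mem_Icc]; omega⟩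

/-- The destination, as a receiver. -/
def dstRx {T : ℕ} (hT : 2 ≤ T) : Rx T := ⟨T, by rw [Finset.mem_Icc]; omega⟩

/-- A relay, as a transmitter. -/
def Relay.toTx {T : ℕ} (s : Relay T) : Tx T :=
  ⟨s.1, by have h := s.2; rw [Finset.mem_Icc] at h ⊢; omega⟩

/-- A relay, as a receiver. -/
def Relay.toRx {T : ℕ} (s : Relay T) : Rx T :=
  ⟨s.1, by have h := s.2; rw [Finset.mem_Icc] at h ⊢; omega⟩

/-- A permutation `π` of the relays `{2, …, T - 1}`, extended by `π t = t` to all other labels;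
in particular `π 0 = 0`, `π 1 = 1`, `π T = T`, `π (T + 1) = T + 1`. The node `π t` is the `t`-th
one on the route of the messages. -/
abbrev RelayOrder (T : ℕ) : Type :=
  {π : Equiv.Perm ℕ // ∀ t : ℕ, t ∉ Finset.Icc 2 (T - 1) → π t = t}

/-- The position `t` of the node `s = π t` on the route. -/
def RelayOrder.pos {T : ℕ} (π : RelayOrder T) (s : ℕ) : ℕ := π.1.symm s

theorem RelayOrder.pos_mem {T : ℕ} (π : RelayOrder T) (s : Rx T) :
    2 ≤ π.pos s.1 ∧ π.pos s.1 ≤ T := by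
  have hs := s.2
  rw [Finset.mem_Icc] at hs
  by_cases h : π.1.symm s.1 ∈ Finset.Icc 2 (T - 1)
  · rw [Finset.mem_Icc] at h
    unfold RelayOrder.pos
    omega
  · have h1 := π.2 _ h
    rw [Equiv.apply_symm_apply] at h1
    unfold RelayOrder.pos
    rw [← h1]
    exact hs

/-! ## Channel and codes -/

/-- A memoryless, time invariant `T`-node multiple-relay channel with finite alphabets: for every
input `(x_1, …, x_{T-1})` a probability mass function of the output `(y_2, …, y_T)`. -/
abbrev RelayChannel (T : ℕ) (X : Tx T → Type*) (Y : Rx T → Type*) [∀ s, Fintype (Y s)] :=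
  (∀ s, X s) → stdSimplex ℝ (∀ s, Y s)

/-- An `(M, N)` code. The input of a relay at a time `i` is a function of the symbols that it
received at the times before `i`. -/
structure RelayCode (T : ℕ) (hT : 2 ≤ T) (X : Tx T → Type*) (Y : Rx T → Type*) (M N : ℕ) where
  source : Fin M → Fin N → X (srcTx hT)
  relay : ∀ (s : Relay T) (i : Fin N), (Fin i → Y s.toRx) → X s.toTx
  decode : (Fin N → Y (dstRx hT)) → Fin M

namespace RelayCode

variable {T : ℕ} {hT : 2 ≤ T} {X : Tx T → Type*} {Y : Rx T → Type*} {M N : ℕ}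

/-- The input of the channel at time `i` if the message is `w` and the outputs are `y`. -/
def input (c : RelayCode T hT X Y M N) (w : Fin M) (y : Fin N → ∀ s, Y s) (i : Fin N)
    (s : Tx T) : X s :=
  if h : s.1 = 1 then
    have e : srcTx hT = s := Subtype.ext h.symm
    e ▸ c.source w i
  else
    let r : Relay T := ⟨s.1, by have h2 := s.2; rw [Finset.mem_Icc] at h2 ⊢; omega⟩
    c.relay r i (fun j => y ⟨j.1, j.2.trans i.2⟩ r.toRx)

/-- The probability of an event about the message and the channel outputs, for a uniformly
distributed message. -/
noncomputable def prob [∀ s, Fintype (Y s)] (ch : RelayChannel T X Y)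
    (c : RelayCode T hT X Y M N) (E : Fin M → (Fin N → ∀ s, Y s) → Prop) : ℝ :=
  open Classical in
  (1 / (M : ℝ)) * ∑ w : Fin M, ∑ y : Fin N → ∀ s, Y s,
    if E w y then ∏ i, ch (c.input w y i) (y i) else 0

/-- The average error probability `Pr {Ŵ ≠ W}`. -/
noncomputable def errorProb [∀ s, Fintype (Y s)] (ch : RelayChannel T X Y)
    (c : RelayCode T hT X Y M N) : ℝ :=
  c.prob ch fun w y => c.decode (fun i => y i (dstRx hT)) ≠ w

/-- The rate, in bits per channel use. -/
noncomputable def rate (_c : RelayCode T hT X Y M N) : ℝ := Real.logb 2 M / N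

end RelayCode

/-! ## Two-hop myopic decode-forward

The message of the code consists of `B` sub-messages `w_1, …, w_B`, each with `m` values, and is
sent in `K = B + T - 2` blocks of `n` channel uses; `w_j` is a fixed dummy for `j ≤ 0` and for
`j > B`. The node at position `t ≥ 2` of the route decodes `w_j` at the end of block `j + t - 2`.
In Lean, sub-message indices `j` are natural numbers (a truncated difference yields the index `0`
of a dummy), and the block `b ∈ {1, …, K}` is the element `b - 1` of `Fin K`. -/

/-- The ingredients of a two-hop myopic decode-forward strategy.

* `enc s b`: in block `b` the node `s` sends a function of two sub-messages only, the one it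
  decoded at the end of block `b - 1` and the one it decoded at the end of block `b - 2` (for the
  source: `w_b` and `w_{b-1}`).
* `listPrev s b`: when it has finished decoding at the end of block `b`, the node `s` forms a list
  of candidates for the sub-message to be decoded at the end of block `b + 1`, from its received
  signal of block `b`, the sub-message it has just decoded and the two before that. The oldest of
  the three, decoded at the end of block `b - 2`, is then discarded.
* `listCur s b`: at the end of block `b` the node `s` forms a list of candidates for the
  sub-message to be decoded now, from its received signal of block `b` and the last two
  sub-messages it has decoded. -/
structure TwoHopScheme (T : ℕ) (X : Tx T → Type*) (Y : Rx T → Type*) (m n B : ℕ) where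
  order : RelayOrder T
  dummy : Fin m
  enc : ∀ s : Tx T, Fin (B + T - 2) → Fin m → Fin m → Fin n → X s
  listPrev : ∀ s : Rx T, Fin (B + T - 2) → (Fin n → Y s) → Fin m → Fin m → Fin m → Finset (Fin m)
  listCur : ∀ s : Rx T, Fin (B + T - 2) → (Fin n → Y s) → Fin m → Fin m → Finset (Fin m)

/-- The part of the sequence `y` that lies in block `b`. -/
def blockOf {α : Type*} {K n : ℕ} (y : Fin (K * n) → α) (b : Fin K) : Fin n → α :=
  fun i => y (finProdFinEquiv (b, i))

/-- The element of `L` if there is exactly one, and `d` otherwise (decoding failure). -/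
noncomputable def uniqueElem {m : ℕ} (L : Finset (Fin m)) (d : Fin m) : Fin m :=
  open Classical in if h : ∃! v, v ∈ L then h.choose else d

namespace TwoHopScheme

variable {T : ℕ} {X : Tx T → Type*} {Y : Rx T → Type*} {m n B : ℕ}

/-- The estimates `(ŵ_j, ŵ_{j-1}, ŵ_{j-2})` that the receiver `s` obtains from `y`. The estimate
of `w_{j+1}` is the unique common element of the list of the current block `j + t - 1` and the
list that was formed in the block before, where `t` is the position of `s`. The node at position
`t = 2` has a single node behind it and uses the list of the current block only. -/
noncomputable def memory (S : TwoHopScheme T X Y m n B) (s : Rx T)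
    (y : Fin ((B + T - 2) * n) → Y s) : ℕ → Fin m × Fin m × Fin m
  | 0 => (S.dummy, S.dummy, S.dummy)
  | j + 1 =>
    let old := S.memory s y j
    let new : Fin m :=
      if h : j < B then
        let t := S.order.pos s.1
        have ht : 2 ≤ t ∧ t ≤ T := S.order.pos_mem s
        let b : Fin (B + T - 2) := ⟨j + t - 2, by omega⟩
        let L := S.listCur s b (blockOf y b) old.1 old.2.1
        if t = 2 then uniqueElem L S.dummy
        else
          let b' : Fin (B + T - 2) := ⟨j + t - 3, by omega⟩
          uniqueElem (S.listPrev s b' (blockOf y b') old.1 old.2.1 old.2.2 ∩ L) S.dummy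
      else S.dummy
    (new, old.1, old.2.1)

/-- The estimate of `w_j` at the receiver `s` (the dummy if `j = 0` or `j > B`). -/
noncomputable def est (S : TwoHopScheme T X Y m n B) (s : Rx T)
    (y : Fin ((B + T - 2) * n) → Y s) (j : ℕ) : Fin m := (S.memory s y j).1

/-- The sub-message `w_j` of the message `w` (the dummy if `j = 0` or `j > B`). -/
def msg (S : TwoHopScheme T X Y m n B) (w : Fin (m ^ B)) (j : ℕ) : Fin m :=
  if h : 1 ≤ j ∧ j ≤ B then (finFunctionFinEquiv.symm w : Fin B → Fin m) ⟨j - 1, by omega⟩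
  else S.dummy

/-- The code `c` operates according to the strategy `S`: in block `b`, the node at position `t`
sends its codeword for `(ŵ_{b-t+1}, ŵ_{b-t})`, and the destination outputs its estimates. -/
structure Implements {hT : 2 ≤ T} (S : TwoHopScheme T X Y m n B)
    (c : RelayCode T hT X Y (m ^ B) ((B + T - 2) * n)) : Prop where
  source : ∀ (w : Fin (m ^ B)) (b : Fin (B + T - 2)) (i : Fin n),
    c.source w (finProdFinEquiv (b, i)) =
      S.enc (srcTx hT) b (S.msg w (b + 1)) (S.msg w b) i
  relay : ∀ (s : Relay T) (y : Fin ((B + T - 2) * n) → Y s.toRx) (b : Fin (B + T - 2))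
      (i : Fin n),
    c.relay s (finProdFinEquiv (b, i)) (fun j => y ⟨j.1, j.2.trans (Fin.is_lt _)⟩) =
      S.enc s.toTx b (S.est s.toRx y (b + 2 - S.order.pos s.1))
        (S.est s.toRx y (b + 1 - S.order.pos s.1)) i
  decode : ∀ (y : Fin ((B + T - 2) * n) → Y (dstRx hT)) (j : ℕ), 1 ≤ j → j ≤ B →
    S.msg (c.decode y) j = S.est (dstRx hT) y j

/-- The probability that some relay, or the destination, decodes some sub-message wrongly. -/
noncomputable def nodeErrorProb [∀ s, Fintype (Y s)] {hT : 2 ≤ T} (ch : RelayChannel T X Y)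
    (S : TwoHopScheme T X Y m n B) (c : RelayCode T hT X Y (m ^ B) ((B + T - 2) * n)) : ℝ :=
  c.prob ch fun w y => ∃ (s : Rx T) (j : ℕ), 1 ≤ j ∧ j ≤ B ∧
    S.est s (fun i => y i s) j ≠ S.msg w j

end TwoHopScheme

/-- The rate `R` is achievable on the channel `ch` using two-hop myopic decode-forward: there are
codes of this kind with rate arbitrarily close to `R` (or larger) and arbitrarily small error
probability, for which moreover all relays decode the messages with arbitrarily small error
probability. -/
def TwoHopAchievable {T : ℕ} (hT : 2 ≤ T) {X : Tx T → Type*} {Y : Rx T → Type*}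
    [∀ s, Fintype (Y s)] (ch : RelayChannel T X Y) (R : ℝ) : Prop :=
  ∀ δ : ℝ, 0 < δ → ∀ ε : ℝ, 0 < ε →
    ∃ (m n B : ℕ) (S : TwoHopScheme T X Y m n B)
      (c : RelayCode T hT X Y (m ^ B) ((B + T - 2) * n)),
      1 ≤ n ∧ 1 ≤ B ∧ S.Implements c ∧
        R - δ ≤ c.rate ∧ c.errorProb ch < ε ∧ S.nodeErrorProb ch c < ε

/-! ## Information quantities -/

/-- The Shannon entropy, in bits, of the random variable `A` on a finite space on which the
probability mass function is `P`. -/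
noncomputable def entropyBits {Ω α : Type*} [Fintype Ω] [Fintype α] (P : Ω → ℝ) (A : Ω → α) : ℝ :=
  open Classical in
  (∑ a : α, Real.negMulLog (∑ ω : Ω, if A ω = a then P ω else 0)) / Real.log 2

/-- The conditional mutual information `I(A; B | C) = H(A | C) - H(A | B, C)`, in bits. -/
noncomputable def condMutualInfo {Ω α β γ : Type*} [Fintype Ω] [Fintype α] [Fintype β] [Fintype γ]
    (P : Ω → ℝ) (A : Ω → α) (B : Ω → β) (C : Ω → γ) : ℝ :=
  (entropyBits P (fun ω => (A ω, C ω)) - entropyBits P C) -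
    (entropyBits P (fun ω => (A ω, B ω, C ω)) - entropyBits P (fun ω => (B ω, C ω)))

/-- The value `u_t` of the auxiliary variable of node `t`, which is `0` for `t ∉ {1, …, T - 1}`. -/
def auxVal {T k : ℕ} (u : Tx T → Fin (k + 1)) (t : ℕ) : Fin (k + 1) :=
  if h : t ∈ Finset.Icc 1 (T - 1) then u ⟨t, h⟩ else 0

/-- The free factors of the joint distribution: `pU s` is the law of `U_s`, and `pX s` is the
conditional law of `X_s` given `U_s` and the auxiliary variable of the node that follows `s` on
the route. All auxiliary variables take values in `{0, …, k}`, with `k` arbitrary; smaller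
alphabets are covered by laws that do not charge all of it. -/
structure TwoHopInput (T : ℕ) (X : Tx T → Type*) [∀ s, Fintype (X s)] where
  k : ℕ
  pU : Tx T → stdSimplex ℝ (Fin (k + 1))
  pX : ∀ s : Tx T, Fin (k + 1) → Fin (k + 1) → stdSimplex ℝ (X s)

namespace TwoHopInput

variable {T : ℕ} {X : Tx T → Type*} {Y : Rx T → Type*} [∀ s, Fintype (X s)] [∀ s, Fintype (Y s)]

/-- The joint distribution `∏ p(u_{π(t)}) ∏ p(x_{π(t)} | u_{π(t)}, u_{π(t+1)}) p*(y | x)`. For the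
last transmitter `π(T-1)` the factor is `p(x_{π(T-1)} | u_{π(T-1)})`, as `u_{π(T)} = 0`. -/
noncomputable def joint (p : TwoHopInput T X) (π : RelayOrder T) (ch : RelayChannel T X Y) :
    (Tx T → Fin (p.k + 1)) × (∀ s, X s) × (∀ s, Y s) → ℝ :=
  fun ω => (∏ s, p.pU s (ω.1 s)) *
    (∏ s : Tx T, p.pX s (ω.1 s) (auxVal ω.1 (π.1 (π.pos s.1 + 1))) (ω.2.1 s)) * ch ω.2.1 ω.2.2

/-- `I(U_{π(t-2)}, U_{π(t-1)}; Y_{π(t)} | U_{π(t)}, U_{π(t+1)})` for the receiver `s = π(t)`. -/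
noncomputable def receptionRate (p : TwoHopInput T X) (π : RelayOrder T) (ch : RelayChannel T X Y)
    (s : Rx T) : ℝ :=
  let t := π.pos s.1
  condMutualInfo (p.joint π ch)
    (fun ω => (auxVal ω.1 (π.1 (t - 2)), auxVal ω.1 (π.1 (t - 1))))
    (fun ω => ω.2.2 s)
    (fun ω => (auxVal ω.1 (π.1 t), auxVal ω.1 (π.1 (t + 1))))

end TwoHopInput

/-- `R_{2-hop}`: the supremum over the relay orders `π` and the distributions `p` (with arbitrary
finite alphabets of the auxiliary variables) of the minimum over the receivers `s = π(t)`,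
`t ∈ {2, …, T}`, taken in the extended reals, so that it needs no side condition. -/
noncomputable def twoHopRate {T : ℕ} {X : Tx T → Type*} {Y : Rx T → Type*} [∀ s, Fintype (X s)]
    [∀ s, Fintype (Y s)] (ch : RelayChannel T X Y) : EReal :=
  ⨆ (π : RelayOrder T) (p : TwoHopInput T X), ⨅ s : Rx T, (p.receptionRate π ch s : EReal)

/-! The proof is random coding with sliding-window decoding over two blocks. Fix an order and an
input distribution all of whose reception rates exceed `r = R - δ / 2`. For every symbol of every
block draw afresh an auxiliary symbol for each node and sub-message, and then the channel inputs for
each pair of sub-messages. Since the blocks have independent codebooks, two different blocks give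
independent evidence about a sub-message.

The receiver at position `t` sees `w_{j+1}` twice: from position `t - 2` in the previous block, and
from position `t - 1` in the current one. In the current block the interference of position `t - 2`
is treated as noise. In the previous block the sub-message of position `t - 1` was `w_j`, which is
known by now. By the chain rule (`condMutualInfo_chain`, `receptionRate_mul_log_two`) the two
informations `I(U_{t-1}; Y_t | U_t, U_{t+1})` and `I(U_{t-2}; Y_t | U_{t-1}, U_t, U_{t+1})` add up
to the reception rate.

Each list contains the candidates whose likelihood ratio reaches a threshold slightly below its
typical size. The true sub-message is missed with exponentially small probability, by a Chernoff
bound (`exists_sum_exp_lt_one`). A wrong candidate has a symbol independent of the output, so its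
mean ratio is at most one (`sum_mul_infoRatio_le_one`). Markov's inequality in both blocks bounds
its chance of being in both lists by `exp (-n (γ₁ + γ₂))`, which beats the number `m ≈ 2 ^ (n r)` of
candidates. This is `sum_step_error_le`.

Error propagation is removed by `nodeErrorProb_le`: the real network and an idealized one, where all
inputs and earlier estimates are correct, coincide as long as no error occurs. A union bound over
receivers and sub-messages and averaging over the codebook give `exists_codebook`. Finally `B` is
fixed large enough to absorb the `T - 2` extra blocks, and `n` tends to infinity. -/

/-! ## Finite sums over product spaces -/

section PiSums

/-- Resampling one coordinate does not change an average over a product distribution. -/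
theorem sum_pi_resample {ι : Type*} {α : ι → Type*} [Fintype ι] [DecidableEq ι]
    [∀ i, Fintype (α i)] (q : ∀ i, α i → ℝ) (i₀ : ι) (hq : ∑ a, q i₀ a = 1)
    (G : (∀ i, α i) → ℝ) :
    ∑ u : ∀ i, α i, (∏ i, q i (u i)) * ∑ a, q i₀ a * G (Function.update u i₀ a) =
      ∑ u : ∀ i, α i, (∏ i, q i (u i)) * G u := by
  have h1 : ∑ u : ∀ i, α i, (∏ i, q i (u i)) * G u =
      ∑ z : (∀ i, α i) × α i₀, (∏ i, q i (z.1 i)) * (q i₀ z.2 * G z.1) := by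
    rw [Fintype.sum_prod_type]
    refine Finset.sum_congr rfl fun u _ => ?_
    simp only
    rw [← Finset.mul_sum, ← Finset.sum_mul, hq, one_mul]
  have h2 : ∑ u : ∀ i, α i, (∏ i, q i (u i)) * ∑ a, q i₀ a * G (Function.update u i₀ a) =
      ∑ z : (∀ i, α i) × α i₀,
        (∏ i, q i (z.1 i)) * (q i₀ z.2 * G (Function.update z.1 i₀ z.2)) := by
    rw [Fintype.sum_prod_type]
    exact Finset.sum_congr rfl fun u _ => Finset.mul_sum _ _ _
  rw [h1, h2]
  -- Exchanging the old coordinate with the fresh sample is an involution that preserves the product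
  -- weight.
  let f : (∀ i, α i) × α i₀ → (∀ i, α i) × α i₀ := fun z => (Function.update z.1 i₀ z.2, z.1 i₀)
  have hf : Function.Involutive f := by
    rintro ⟨u, a⟩
    simp [f]
  refine Fintype.sum_equiv hf.toPerm _ _ ?_
  rintro ⟨u, a⟩
  simp only [Function.Involutive.coe_toPerm, f]
  have e1 := Finset.mul_prod_erase Finset.univ (fun i => q i (u i)) (Finset.mem_univ i₀)
  have e2 := Finset.mul_prod_erase Finset.univ (fun i => q i (Function.update u i₀ a i))
    (Finset.mem_univ i₀)
  have e3 : ∏ i ∈ Finset.univ.erase i₀, q i (Function.update u i₀ a i) =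
      ∏ i ∈ Finset.univ.erase i₀, q i (u i) := by
    refine Finset.prod_congr rfl fun i hi => ?_
    rw [Function.update_of_ne (Finset.ne_of_mem_erase hi)]
  simp only [Function.update_self] at e2
  rw [← e1, ← e2, e3]
  ring

/-- A coordinate of a product distribution is independent of the functions of the others. -/
theorem sum_pi_indep {ι α : Type*} [Fintype ι] [DecidableEq ι] [Fintype α] [DecidableEq α]
    (q : ι → α → ℝ) (i₀ : ι) (hq : ∑ a, q i₀ a = 1) (g : (ι → α) → ℝ)
    (hg : ∀ u a, g (Function.update u i₀ a) = g u) (a₀ : α) :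
    ∑ u : ι → α, (∏ i, q i (u i)) * (if u i₀ = a₀ then g u else 0) =
      q i₀ a₀ * ∑ u : ι → α, (∏ i, q i (u i)) * g u := by
  rw [← sum_pi_resample q i₀ hq, Finset.mul_sum]
  refine Finset.sum_congr rfl fun u _ => ?_
  simp only [Function.update_self, hg, mul_ite, mul_zero, Finset.sum_ite_eq', Finset.mem_univ,
    if_true]
  ring

/-- The law of one coordinate under a product distribution. -/
theorem sum_pi_eval_one {D β : Type*} [Fintype D] [DecidableEq D] [Fintype β] [DecidableEq β]
    (q : D → β → ℝ) (hq : ∀ d, ∑ a, q d a = 1) (d₀ : D) (x : β) :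
    ∑ f : D → β, (∏ d, q d (f d)) * (if f d₀ = x then 1 else 0) = q d₀ x := by
  have h : ∀ f : D → β, (∏ d, q d (f d)) * (if f d₀ = x then (1 : ℝ) else 0) =
      ∏ d, q d (f d) * (if d = d₀ then (if f d = x then 1 else 0) else 1) := by
    intro f
    rw [Finset.prod_mul_distrib]
    congr 1
    simp
  simp_rw [h]
  rw [← Fintype.prod_sum (fun d a => q d a * (if d = d₀ then (if a = x then (1 : ℝ) else 0) else 1)),
    Finset.prod_eq_single d₀]
  · simp
  · intro d _ hd
    simp [hd, hq]
  · simp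

/-- The joint law of one coordinate of each of several independent random functions. -/
theorem sum_pi_eval {ι D : Type*} {β : ι → Type*} [Fintype ι] [DecidableEq ι] [Fintype D]
    [DecidableEq D] [∀ i, Fintype (β i)] (q : ∀ i, D → β i → ℝ)
    (hq : ∀ i d, ∑ a, q i d a = 1) (d₀ : ι → D) (g : (∀ i, β i) → ℝ) :
    ∑ f : ∀ i, D → β i, (∏ i, ∏ d, q i d (f i d)) * g (fun i => f i (d₀ i)) =
      ∑ x : ∀ i, β i, (∏ i, q i (d₀ i) (x i)) * g x := by
  classical
  -- Expanding `g` in indicators of points makes each term a product over `i`, so the sum over `f`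
  -- factorizes.
  have h : ∀ f : ∀ i, D → β i, g (fun i => f i (d₀ i)) =
      ∑ x : ∀ i, β i, (∏ i, if f i (d₀ i) = x i then (1 : ℝ) else 0) * g x := by
    intro f
    rw [Finset.sum_eq_single (fun i => f i (d₀ i))]
    · simp
    · intro x _ hx
      obtain ⟨i, hi⟩ := Function.ne_iff.1 hx
      rw [Finset.prod_eq_zero (Finset.mem_univ i), zero_mul]
      rw [if_neg (fun e => hi e.symm)]
    · simp
  simp_rw [h, Finset.mul_sum]
  rw [Finset.sum_comm]
  refine Finset.sum_congr rfl fun x _ => ?_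
  simp_rw [← mul_assoc, ← Finset.prod_mul_distrib]
  rw [← Finset.sum_mul]
  congr 1
  rw [← Fintype.prod_sum
    (fun i (f : D → β i) => (∏ d, q i d (f d)) * (if f (d₀ i) = x i then (1 : ℝ) else 0))]
  exact Finset.prod_congr rfl fun i _ => sum_pi_eval_one (q i) (hq i) (d₀ i) (x i)

theorem sum_pi_prod_eq_one {ι : Type*} {β : ι → Type*} [Fintype ι] [DecidableEq ι]
    [∀ i, Fintype (β i)] (q : ∀ i, β i → ℝ) (hq : ∀ i, ∑ a, q i a = 1) :
    ∑ f : ∀ i, β i, ∏ i, q i (f i) = 1 := by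
  rw [← Fintype.prod_sum]
  simp [hq]

/-- A product of conditional probabilities of the present given the past sums to one. -/
theorem sum_causal_prod_eq_one {α : Type*} [Fintype α] [Nonempty α] :
    ∀ (N : ℕ) (f : Fin N → (Fin N → α) → α → ℝ)
      (_ : ∀ i y y', (∀ j < i, y j = y' j) → f i y = f i y')
      (_ : ∀ i y, ∑ a, f i y a = 1), ∑ y : Fin N → α, ∏ i, f i y (y i) = 1
  | 0, f, _, _ => by simp
  | N + 1, f, hc, hs => by
    -- An arbitrary filler for the last symbol: by causality no factor looks at it, so the last
    -- symbol can be summed out first.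
    obtain ⟨a₀⟩ := ‹Nonempty α›
    rw [← (Fin.snocEquiv (fun _ : Fin (N + 1) => α)).sum_comp, Fintype.sum_prod_type_right]
    change ∑ y : Fin N → α, ∑ a, ∏ i, f i (Fin.snoc (α := fun _ => α) y a)
      (Fin.snoc (α := fun _ => α) y a i) = 1
    have h : ∀ (y : Fin N → α) (a : α),
        ∏ i, f i (Fin.snoc (α := fun _ => α) y a) (Fin.snoc (α := fun _ => α) y a i) =
          (∏ i : Fin N, f i.castSucc (Fin.snoc (α := fun _ => α) y a₀) (y i)) *
            f (Fin.last N) (Fin.snoc (α := fun _ => α) y a₀) a := by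
      intro y a
      rw [Fin.prod_univ_castSucc]
      have key : ∀ (i : Fin (N + 1)), f i (Fin.snoc (α := fun _ => α) y a) =
          f i (Fin.snoc (α := fun _ => α) y a₀) := by
        intro i
        refine hc _ _ _ fun j hj => ?_
        obtain ⟨j, rfl⟩ := Fin.exists_castSucc_eq.2 (ne_of_lt (lt_of_lt_of_le hj (Fin.le_last i)))
        simp
      simp [key]
    simp_rw [h, ← Finset.mul_sum, hs, mul_one]
    refine sum_causal_prod_eq_one N
      (fun i y => f i.castSucc (Fin.snoc (α := fun _ => α) y a₀)) ?_ ?_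
    · intro i y y' hy
      refine hc _ _ _ fun j hj => ?_
      have hj' : j.1 < N := lt_of_lt_of_le (Fin.lt_def.1 hj) (by simp)
      obtain ⟨j, rfl⟩ : ∃ k : Fin N, j = k.castSucc := ⟨⟨j.1, hj'⟩, rfl⟩
      simpa using hy j (by simpa using hj)
    · intro i y
      exact hs _ _

end PiSums

/-! ## Information densities -/

section InfoDensity

variable {Ω α β γ δ : Type*} [Fintype Ω]

/-- The probability that the random variable `A` takes the value `a`. -/
noncomputable def marg (P : Ω → ℝ) (A : Ω → α) (a : α) : ℝ :=
  open Classical in ∑ ω : Ω, if A ω = a then P ω else 0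

/-- The exponential `p(a, b | c) / (p(a | c) p(b | c))` of the conditional information density. -/
noncomputable def infoRatio (P : Ω → ℝ) (A : Ω → α) (B : Ω → β) (C : Ω → γ) (a : α) (b : β)
    (c : γ) : ℝ :=
  marg P (fun ω => (A ω, B ω, C ω)) (a, b, c) * marg P C c /
    (marg P (fun ω => (A ω, C ω)) (a, c) * marg P (fun ω => (B ω, C ω)) (b, c))

theorem marg_nonneg {P : Ω → ℝ} (hP : ∀ ω, 0 ≤ P ω) (A : Ω → α) (a : α) : 0 ≤ marg P A a :=
  Finset.sum_nonneg fun ω _ => by split_ifs <;> simp [hP]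

theorem marg_pos {P : Ω → ℝ} (hP : ∀ ω, 0 ≤ P ω) (A : Ω → α) {ω : Ω} (hω : 0 < P ω) :
    0 < marg P A (A ω) := by
  classical
  refine Finset.sum_pos' (fun ω _ => by split_ifs <;> simp [hP]) ⟨ω, Finset.mem_univ _, ?_⟩
  simpa using hω

theorem marg_congr (P : Ω → ℝ) {A : Ω → α} {B : Ω → β} {a : α} {b : β}
    (h : ∀ ω, A ω = a ↔ B ω = b) : marg P A a = marg P B b := by
  classical
  exact Finset.sum_congr rfl fun ω _ => by simp only [h ω]

theorem infoRatio_nonneg {P : Ω → ℝ} (hP : ∀ ω, 0 ≤ P ω) (A : Ω → α) (B : Ω → β) (C : Ω → γ)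
    (a : α) (b : β) (c : γ) : 0 ≤ infoRatio P A B C a b c :=
  div_nonneg (mul_nonneg (marg_nonneg hP _ _) (marg_nonneg hP _ _))
    (mul_nonneg (marg_nonneg hP _ _) (marg_nonneg hP _ _))

theorem infoRatio_pos {P : Ω → ℝ} (hP : ∀ ω, 0 ≤ P ω) (A : Ω → α) (B : Ω → β) (C : Ω → γ)
    {ω : Ω} (hω : 0 < P ω) : 0 < infoRatio P A B C (A ω) (B ω) (C ω) :=
  div_pos (mul_pos (marg_pos hP (fun ω => (A ω, B ω, C ω)) hω) (marg_pos hP C hω))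
    (mul_pos (marg_pos hP (fun ω => (A ω, C ω)) hω) (marg_pos hP (fun ω => (B ω, C ω)) hω))

theorem sum_marg_mul [Fintype α] (P : Ω → ℝ) (A : Ω → α) (f : α → ℝ) :
    ∑ a, marg P A a * f a = ∑ ω, P ω * f (A ω) := by
  classical
  unfold marg
  simp_rw [Finset.sum_mul]
  rw [Finset.sum_comm]
  refine Finset.sum_congr rfl fun ω _ => ?_
  simp

theorem entropyBits_mul_log_two [Fintype α] (P : Ω → ℝ) (A : Ω → α) :
    entropyBits P A * Real.log 2 = -∑ ω, P ω * Real.log (marg P A (A ω)) := by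
  have h2 : Real.log 2 ≠ 0 := (Real.log_pos one_lt_two).ne'
  unfold entropyBits
  rw [div_mul_cancel₀ _ h2, ← sum_marg_mul P A (fun a => Real.log (marg P A a)),
    ← Finset.sum_neg_distrib]
  refine Finset.sum_congr rfl fun a _ => ?_
  rw [Real.negMulLog, marg, neg_mul]

/-- Each entropy is an expected negative log-marginal. The logarithm of the ratio may be split only
where all marginals are positive, which holds at outcomes of positive mass; the others contribute
zero. -/
theorem condMutualInfo_mul_log_two [Fintype α] [Fintype β] [Fintype γ] {P : Ω → ℝ}
    (hP : ∀ ω, 0 ≤ P ω) (A : Ω → α) (B : Ω → β) (C : Ω → γ) :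
    condMutualInfo P A B C * Real.log 2 =
      ∑ ω, P ω * Real.log (infoRatio P A B C (A ω) (B ω) (C ω)) := by
  have h : condMutualInfo P A B C * Real.log 2 =
      (entropyBits P (fun ω => (A ω, C ω)) * Real.log 2 - entropyBits P C * Real.log 2) -
      (entropyBits P (fun ω => (A ω, B ω, C ω)) * Real.log 2 -
        entropyBits P (fun ω => (B ω, C ω)) * Real.log 2) := by
    unfold condMutualInfo
    ring
  rw [h]
  simp only [entropyBits_mul_log_two]
  simp only [← Finset.sum_neg_distrib, ← Finset.sum_sub_distrib]
  refine Finset.sum_congr rfl fun ω _ => ?_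
  rcases (hP ω).eq_or_lt with h0 | h0
  · simp [← h0]
  · have e1 := marg_pos hP (fun ω => (A ω, B ω, C ω)) h0
    have e2 := marg_pos hP C h0
    have e3 := marg_pos hP (fun ω => (A ω, C ω)) h0
    have e4 := marg_pos hP (fun ω => (B ω, C ω)) h0
    unfold infoRatio
    rw [Real.log_div (mul_pos e1 e2).ne' (mul_pos e3 e4).ne', Real.log_mul e1.ne' e2.ne',
      Real.log_mul e3.ne' e4.ne']
    ring

/-- Chain rule for the mutual information, in nats. -/
theorem condMutualInfo_chain [Fintype α] [Fintype β] [Fintype γ] [Fintype δ] {P : Ω → ℝ}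
    (hP : ∀ ω, 0 ≤ P ω) (A' : Ω → δ) (A : Ω → α) (B : Ω → β) (C : Ω → γ) :
    condMutualInfo P (fun ω => (A' ω, A ω)) B C * Real.log 2 =
      (∑ ω, P ω * Real.log (infoRatio P A B C (A ω) (B ω) (C ω))) +
      ∑ ω, P ω * Real.log (infoRatio P A' B (fun ω => (A ω, C ω)) (A' ω) (B ω) (A ω, C ω)) := by
  rw [condMutualInfo_mul_log_two hP, ← Finset.sum_add_distrib]
  refine Finset.sum_congr rfl fun ω _ => ?_
  rcases (hP ω).eq_or_lt with h0 | h0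
  · simp [← h0]
  · rw [← mul_add, ← Real.log_mul (infoRatio_pos hP A B C h0).ne'
      (infoRatio_pos hP A' B (fun ω => (A ω, C ω)) h0).ne']
    congr 2
    have c1 : marg P (fun ω => ((A' ω, A ω), B ω, C ω)) ((A' ω, A ω), B ω, C ω) =
        marg P (fun ω => (A' ω, B ω, A ω, C ω)) (A' ω, B ω, A ω, C ω) := by
      refine marg_congr P fun ω' => ?_
      simp only [Prod.mk.injEq]
      tauto
    have c2 : marg P (fun ω => ((A' ω, A ω), C ω)) ((A' ω, A ω), C ω) =
        marg P (fun ω => (A' ω, A ω, C ω)) (A' ω, A ω, C ω) := by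
      refine marg_congr P fun ω' => ?_
      simp only [Prod.mk.injEq]
      tauto
    have c3 : marg P (fun ω => (B ω, A ω, C ω)) (B ω, A ω, C ω) =
        marg P (fun ω => (A ω, B ω, C ω)) (A ω, B ω, C ω) := by
      refine marg_congr P fun ω' => ?_
      simp only [Prod.mk.injEq]
      tauto
    have e1 := marg_pos hP (fun ω => (A ω, B ω, C ω)) h0
    have e3 := marg_pos hP (fun ω => (A ω, C ω)) h0
    unfold infoRatio
    rw [c1, c2, c3]
    field_simp

theorem infoRatio_const {P : Ω → ℝ} (hP : ∀ ω, 0 ≤ P ω) (a : α) (B : Ω → β) (C : Ω → γ)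
    {ω : Ω} (hω : 0 < P ω) : infoRatio P (fun _ => a) B C a (B ω) (C ω) = 1 := by
  have e2 := marg_pos hP C hω
  have e4 := marg_pos hP (fun ω => (B ω, C ω)) hω
  have c1 : marg P (fun ω => (a, B ω, C ω)) (a, B ω, C ω) =
      marg P (fun ω => (B ω, C ω)) (B ω, C ω) := by
    refine marg_congr P fun ω' => ?_
    simp
  have c2 : marg P (fun ω => (a, C ω)) (a, C ω) = marg P C (C ω) := by
    refine marg_congr P fun ω' => ?_
    simp
  unfold infoRatio
  rw [c1, c2]
  field_simp

/-- The expectation of the information ratio if `A` is replaced by an independent copy. -/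
theorem sum_mul_infoRatio_le_one [Fintype α] [Fintype β] [Fintype γ] {P : Ω → ℝ}
    (hP : ∀ ω, 0 ≤ P ω) (hP1 : ∑ ω, P ω = 1) (A : Ω → α) (B : Ω → β) (C : Ω → γ) (q : α → ℝ)
    (hA : ∀ a c, marg P (fun ω => (A ω, C ω)) (a, c) = q a * marg P C c) :
    ∑ a, q a * ∑ ω, P ω * infoRatio P A B C a (B ω) (C ω) ≤ 1 := by
  -- The bound is termwise against the law of `(A, B, C)`: where no denominator vanishes the terms
  -- agree, and elsewhere division by zero makes the left one `0`. Hence only an inequality.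
  have h1 : ∑ x : α × β × γ, marg P (fun ω => (A ω, B ω, C ω)) x = 1 := by
    have := sum_marg_mul P (fun ω => (A ω, B ω, C ω)) (fun _ => 1)
    simpa [hP1] using this
  rw [← h1, Fintype.sum_prod_type]
  refine Finset.sum_le_sum fun a _ => ?_
  have h2 := sum_marg_mul P (fun ω => (B ω, C ω)) (fun x => infoRatio P A B C a x.1 x.2)
  simp only at h2
  rw [← h2, Finset.mul_sum]
  refine Finset.sum_le_sum fun x _ => ?_
  obtain ⟨b, c⟩ := x
  simp only [infoRatio, hA]
  have e0 := marg_nonneg hP (fun ω => (A ω, B ω, C ω)) (a, b, c)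
  set M := marg P (fun ω => (A ω, B ω, C ω)) (a, b, c)
  set N := marg P (fun ω => (B ω, C ω)) (b, c)
  set K := marg P C c
  by_cases hq : q a = 0
  · simpa [hq] using e0
  by_cases hN : N = 0
  · simpa [hN] using e0
  by_cases hK : K = 0
  · simpa [hK] using e0
  refine le_of_eq ?_
  field_simp

/-- Exponential bound: a random variable of positive mean has a moment generating function that is
less than one somewhere on the negative axis. -/
theorem exists_sum_exp_lt_one (P f : Ω → ℝ) (hP1 : ∑ ω, P ω = 1) (hf : 0 < ∑ ω, P ω * f ω) :
    ∃ l : ℝ, 0 < l ∧ ∑ ω, P ω * Real.exp (-l * f ω) < 1 := by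
  -- At `0` the moment generating function equals one and its derivative is minus the mean, so it
  -- drops below one immediately to the right.
  have hd : HasDerivAt (fun l : ℝ => ∑ ω, P ω * Real.exp (-l * f ω))
      (∑ ω, P ω * (Real.exp (-0 * f ω) * (-1 * f ω))) 0 := by
    refine HasDerivAt.fun_sum fun ω _ => ?_
    exact ((((hasDerivAt_id (0 : ℝ)).neg).mul_const (f ω)).exp).const_mul (P ω)
  have hneg : ∑ ω, P ω * (Real.exp (-0 * f ω) * (-1 * f ω)) < 0 := by
    have : ∑ ω, P ω * (Real.exp (-0 * f ω) * (-1 * f ω)) = -∑ ω, P ω * f ω := by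
      rw [← Finset.sum_neg_distrib]
      refine Finset.sum_congr rfl fun ω _ => ?_
      simp
    linarith
  have hs := hd.hasDerivWithinAt (s := Set.Ioi 0)
  have h := (hasDerivWithinAt_iff_tendsto_slope' (by simp)).1 hs
  have h' := (h.eventually (gt_mem_nhds hneg)).and self_mem_nhdsWithin
  obtain ⟨l, hl, hl0⟩ := h'.exists
  have hl0' : (0 : ℝ) < l := hl0
  refine ⟨l, hl0', ?_⟩
  rw [slope_def_field] at hl
  simp only [sub_zero, neg_zero, zero_mul, Real.exp_zero, mul_one, hP1] at hl
  have := (div_lt_iff₀ hl0').1 hl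
  linarith

end InfoDensity

/-! ## Reduction to correct side information -/

theorem RelayCode.input_source {T : ℕ} {hT : 2 ≤ T} {X : Tx T → Type*} {Y : Rx T → Type*}
    {M N : ℕ} (c : RelayCode T hT X Y M N) (w : Fin M) (y : Fin N → ∀ s, Y s) (i : Fin N) :
    c.input w y i (srcTx hT) = c.source w i :=
  dif_pos rfl

theorem RelayCode.input_relay {T : ℕ} {hT : 2 ≤ T} {X : Tx T → Type*} {Y : Rx T → Type*}
    {M N : ℕ} (c : RelayCode T hT X Y M N) (w : Fin M) (y : Fin N → ∀ s, Y s) (i : Fin N)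
    (s : Relay T) :
    c.input w y i s.toTx = c.relay s i fun j => y ⟨j.1, j.2.trans i.2⟩ s.toRx :=
  dif_neg (show ¬ s.1 = 1 by have := Finset.mem_Icc.1 s.2; omega)

theorem Tx.eq_source_or_relay {T : ℕ} (hT : 2 ≤ T) (s : Tx T) :
    s = srcTx hT ∨ ∃ r : Relay T, s = r.toTx := by
  by_cases hs : s.1 = 1
  · exact Or.inl (Subtype.ext hs)
  · have h2 := Finset.mem_Icc.1 s.2
    exact Or.inr ⟨⟨s.1, Finset.mem_Icc.2 (by omega)⟩, rfl⟩

theorem RelayCode.sum_input_eq_one {T : ℕ} {hT : 2 ≤ T} {X : Tx T → Type*} {Y : Rx T → Type*}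
    {M N : ℕ} [∀ s, Fintype (Y s)] [Nonempty (∀ s, Y s)] (ch : RelayChannel T X Y)
    (c : RelayCode T hT X Y M N) (w : Fin M) :
    ∑ y : Fin N → ∀ s, Y s, ∏ i, ch (c.input w y i) (y i) = 1 := by
  refine sum_causal_prod_eq_one N (fun i y a => ch (c.input w y i) a) ?_ ?_
  · intro i y y' h
    have : c.input w y i = c.input w y' i := by
      funext s
      obtain rfl | ⟨r, rfl⟩ := Tx.eq_source_or_relay hT s
      · simp only [RelayCode.input_source]
      · simp only [RelayCode.input_relay]
        congr 1
        funext j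
        rw [h ⟨j.1, j.2.trans i.2⟩ j.2]
    simp only [this]
  · intro i y
    exact (ch _).2.2

namespace TwoHopScheme

variable {T : ℕ} {X : Tx T → Type*} {Y : Rx T → Type*} {m n B : ℕ}

/-- The estimate of `w_{j+1}` at the receiver `s` if `v₁, v₂, v₃` are its estimates of
`w_j, w_{j-1}, w_{j-2}` and `y` is its received signal. -/
noncomputable def step (S : TwoHopScheme T X Y m n B) (s : Rx T)
    (y : Fin (B + T - 2) → Fin n → Y s) (j : ℕ) (v₁ v₂ v₃ : Fin m) : Fin m :=
  if h : j < B then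
    let t := S.order.pos s.1
    have ht : 2 ≤ t ∧ t ≤ T := S.order.pos_mem s
    let b : Fin (B + T - 2) := ⟨j + t - 2, by omega⟩
    let L := S.listCur s b (y b) v₁ v₂
    if t = 2 then uniqueElem L S.dummy
    else
      let b' : Fin (B + T - 2) := ⟨j + t - 3, by omega⟩
      uniqueElem (S.listPrev s b' (y b') v₁ v₂ v₃ ∩ L) S.dummy
  else S.dummy

theorem memory_succ (S : TwoHopScheme T X Y m n B) (s : Rx T)
    (y : Fin ((B + T - 2) * n) → Y s) (j : ℕ) :
    S.memory s y (j + 1) =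
      (S.step s (blockOf y) j (S.memory s y j).1 (S.memory s y j).2.1 (S.memory s y j).2.2,
        (S.memory s y j).1, (S.memory s y j).2.1) := rfl

theorem msg_zero (S : TwoHopScheme T X Y m n B) (w : Fin (m ^ B)) : S.msg w 0 = S.dummy := by
  simp [msg]

/-- The estimates are correct if each of them is correct given correct earlier estimates. -/
theorem memory_eq_msg (S : TwoHopScheme T X Y m n B) (s : Rx T)
    (y : Fin ((B + T - 2) * n) → Y s) (w : Fin (m ^ B))
    (h : ∀ j < B, S.step s (blockOf y) j (S.msg w j) (S.msg w (j - 1)) (S.msg w (j - 2)) =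
      S.msg w (j + 1)) (j : ℕ) :
    S.memory s y j = (S.msg w j, S.msg w (j - 1), S.msg w (j - 2)) := by
  induction j with
  | zero => simp [memory, msg_zero]
  | succ j ih =>
    rw [memory_succ, ih]
    have e : j + 1 - 2 = j - 1 := by omega
    simp only [Nat.add_sub_cancel, e, Prod.mk.injEq, and_true]
    by_cases hj : j < B
    · exact h j hj
    · have h1 : ¬ (j + 1 ≤ B) := by omega
      simp [step, hj, msg, h1]

/-- The estimates depend only on the blocks that have been received before they are formed. -/
theorem memory_congr (S : TwoHopScheme T X Y m n B) (s : Rx T)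
    (y y' : Fin ((B + T - 2) * n) → Y s) (j : ℕ)
    (h : ∀ b : Fin (B + T - 2), b.1 + 3 ≤ j + S.order.pos s.1 → blockOf y b = blockOf y' b) :
    S.memory s y j = S.memory s y' j := by
  induction j with
  | zero => rfl
  | succ j ih =>
    rw [memory_succ, memory_succ, ih fun b hb => h b (by omega)]
    have ht := S.order.pos_mem s
    congr 1
    unfold step
    by_cases hj : j < B
    · simp only [hj, dif_pos]
      rw [h ⟨j + S.order.pos s.1 - 2, by omega⟩ (by simp only; omega)]
      by_cases h2 : S.order.pos s.1 = 2
      · simp only [h2, if_true]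
      · simp only [h2, if_false]
        rw [h ⟨j + S.order.pos s.1 - 3, by omega⟩ (by simp only; omega)]
    · simp only [hj, dif_neg, not_false_eq_true]

/-- This is the causality of the relays. For `j > 0` the last block that enters the estimate has
zero-based index `j + t - 3`, which is below `b`; the index `0` is separate because truncation would
spoil this count. -/
theorem est_congr (S : TwoHopScheme T X Y m n B) (s : Rx T)
    (y y' : Fin ((B + T - 2) * n) → Y s) (b : Fin (B + T - 2)) (j : ℕ)
    (hj : j ≤ b.1 + 2 - S.order.pos s.1)
    (h : ∀ b' < b, blockOf y b' = blockOf y' b') : S.est s y j = S.est s y' j := by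
  rcases Nat.eq_zero_or_pos j with rfl | h0
  · rfl
  · unfold est
    rw [S.memory_congr s y y' j fun b' hb' => h b' (Fin.lt_def.2 (by omega))]

/-- The channel input of the scheme if all nodes know all sub-messages that they need. -/
def idealInput (S : TwoHopScheme T X Y m n B) (w : Fin (m ^ B)) (τ : Fin (B + T - 2) × Fin n)
    (s : Tx T) : X s :=
  S.enc s τ.1 (S.msg w (τ.1.1 + 2 - S.order.pos s.1)) (S.msg w (τ.1.1 + 1 - S.order.pos s.1)) τ.2

theorem order_pos_one (π : RelayOrder T) : π.pos 1 = 1 := by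
  unfold RelayOrder.pos
  rw [Equiv.symm_apply_eq]
  exact (π.2 1 (by simp)).symm

theorem input_eq {hT : 2 ≤ T} {S : TwoHopScheme T X Y m n B}
    {c : RelayCode T hT X Y (m ^ B) ((B + T - 2) * n)} (hc : S.Implements c) (w : Fin (m ^ B))
    (y : Fin ((B + T - 2) * n) → ∀ s, Y s)
    (h : ∀ s : Rx T, ∀ j, S.est s (fun i => y i s) j = S.msg w j)
    (τ : Fin (B + T - 2) × Fin n) : c.input w y (finProdFinEquiv τ) = S.idealInput w τ := by
  obtain ⟨b, i⟩ := τ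
  funext s
  obtain rfl | ⟨r, rfl⟩ := Tx.eq_source_or_relay hT s
  · rw [RelayCode.input_source, hc.source, idealInput, show S.order.pos (srcTx hT).1 = 1 from
      order_pos_one _]
    rfl
  · rw [RelayCode.input_relay]
    have := hc.relay r (fun i => y i r.toRx) b i
    rw [h, h] at this
    exact this

open Classical in
/-- The probability that some node errs is at most the probability that, with correct earlier
estimates and inputs, some estimate is wrong. -/
theorem nodeErrorProb_le [∀ s, Fintype (Y s)] [Nonempty (∀ s, Y s)] {hT : 2 ≤ T}
    (ch : RelayChannel T X Y) {S : TwoHopScheme T X Y m n B}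
    {c : RelayCode T hT X Y (m ^ B) ((B + T - 2) * n)} (hc : S.Implements c) :
    S.nodeErrorProb ch c ≤ (1 / ((m ^ B : ℕ) : ℝ)) * ∑ w : Fin (m ^ B),
      ∑ y : Fin (B + T - 2) × Fin n → ∀ s, Y s,
        if ∃ s : Rx T, ∃ j < B, S.step s (fun b i => y (b, i) s) j (S.msg w j) (S.msg w (j - 1))
          (S.msg w (j - 2)) ≠ S.msg w (j + 1)
        then ∏ τ, ch (S.idealInput w τ) (y τ) else 0 := by
  unfold nodeErrorProb RelayCode.prob
  refine mul_le_mul_of_nonneg_left (Finset.sum_le_sum fun w _ => ?_) (by positivity)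
  let e : (Fin (B + T - 2) × Fin n → ∀ s, Y s) ≃ (Fin ((B + T - 2) * n) → ∀ s, Y s) :=
    finProdFinEquiv.arrowCongr (Equiv.refl _)
  have he : ∀ y τ, e y (finProdFinEquiv τ) = y τ := fun y τ => by simp [e]
  have hprod : ∀ y, ∏ i, ch (c.input w (e y) i) (e y i) =
      ∏ τ, ch (c.input w (e y) (finProdFinEquiv τ)) (y τ) := fun y => by
    rw [← finProdFinEquiv.prod_comp]
    simp only [he]
  have hone := c.sum_input_eq_one ch w
  rw [← e.sum_comp] at hone ⊢
  simp only [hprod] at hone ⊢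
  have hone' : ∑ y : Fin (B + T - 2) × Fin n → ∀ s, Y s, ∏ τ, ch (S.idealInput w τ) (y τ) = 1 :=
    sum_pi_prod_eq_one (fun τ a => ch (S.idealInput w τ) a) fun τ => (ch _).2.2
  -- Both output laws have total mass one, so the complements may be compared. Where all idealized
  -- steps succeed, all estimates are correct by `memory_eq_msg`, and both laws give the output the
  -- same weight.
  rw [← sub_le_sub_iff_left (1 : ℝ)]
  nth_rewrite 1 [← hone']
  rw [← hone, ← Finset.sum_sub_distrib, ← Finset.sum_sub_distrib]
  refine Finset.sum_le_sum fun y _ => ?_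
  have hnn : ∀ x : Fin (B + T - 2) × Fin n → ∀ s, X s, 0 ≤ ∏ τ, ch (x τ) (y τ) :=
    fun x => Finset.prod_nonneg fun τ _ => (ch _).2.1 _
  split_ifs with h1 h2 h2
  · simp
  · simpa using hnn _
  · obtain ⟨s, j, hj1, hjB, hne⟩ := h2
    push Not at h1
    refine absurd ?_ hne
    have := S.memory_eq_msg s (fun i => e y i s) w (fun j hj => ?_) j
    · simp [est, this]
    · rw [← h1 s j hj]
      congr 1
      funext b i
      simp [blockOf, he]
  · push Not at h1
    have hmem : ∀ s : Rx T, ∀ j, S.est s (fun i => e y i s) j = S.msg w j := by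
      intro s j
      have := S.memory_eq_msg s (fun i => e y i s) w (fun j hj => ?_) j
      · simp [est, this]
      · rw [← h1 s j hj]
        congr 1
        funext b i
        simp [blockOf, he]
    simp only [input_eq hc w (e y) hmem]
    exact le_rfl

theorem errorProb_le_nodeErrorProb [∀ s, Fintype (Y s)] {hT : 2 ≤ T}
    (ch : RelayChannel T X Y) {S : TwoHopScheme T X Y m n B}
    {c : RelayCode T hT X Y (m ^ B) ((B + T - 2) * n)} (hc : S.Implements c) :
    c.errorProb ch ≤ S.nodeErrorProb ch c := by
  classical
  unfold nodeErrorProb RelayCode.errorProb RelayCode.prob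
  refine mul_le_mul_of_nonneg_left (Finset.sum_le_sum fun w _ => Finset.sum_le_sum fun y _ => ?_)
    (by positivity)
  have hnn : 0 ≤ ∏ i, ch (c.input w y i) (y i) := Finset.prod_nonneg fun τ _ => (ch _).2.1 _
  split_ifs with h1 h2 h2
  · exact le_rfl
  · push Not at h2
    refine absurd ?_ h1
    apply finFunctionFinEquiv.symm.injective
    funext j
    have e1 := hc.decode (fun i => y i (dstRx hT)) (j + 1) (by omega) j.2
    rw [h2 (dstRx hT) (j + 1) (by omega) j.2] at e1
    have hj : j.1 + 1 ≤ B := j.2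
    simpa [msg, hj] using e1
  · exact hnn
  · exact le_rfl

/-- A relay evaluates its estimates on its past, extended arbitrarily into the future. By
`est_congr` the extension does not affect the estimates that it needs. -/
theorem exists_implements [∀ s, Nonempty (Y s)] (hT : 2 ≤ T) (S : TwoHopScheme T X Y m n B) :
    ∃ c : RelayCode T hT X Y (m ^ B) ((B + T - 2) * n), S.Implements c := by
  classical
  let ext (s : Relay T) (i : Fin ((B + T - 2) * n)) (past : Fin i → Y s.toRx)
      (j : Fin ((B + T - 2) * n)) : Y s.toRx :=
    if h : j < i then past ⟨j.1, h⟩ else Classical.arbitrary _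
  refine ⟨⟨fun w i => S.enc (srcTx hT) (finProdFinEquiv.symm i).1
      (S.msg w ((finProdFinEquiv.symm i).1 + 1)) (S.msg w (finProdFinEquiv.symm i).1)
      (finProdFinEquiv.symm i).2,
    fun s i past => S.enc s.toTx (finProdFinEquiv.symm i).1
      (S.est s.toRx (ext s i past) ((finProdFinEquiv.symm i).1 + 2 - S.order.pos s.1))
      (S.est s.toRx (ext s i past) ((finProdFinEquiv.symm i).1 + 1 - S.order.pos s.1))
      (finProdFinEquiv.symm i).2,
    fun y => finFunctionFinEquiv fun j => S.est (dstRx hT) y (j + 1)⟩, ?_, ?_, ?_⟩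
  · intro w b i
    simp only [Equiv.symm_apply_apply]
  · intro s y b i
    simp only [Equiv.symm_apply_apply]
    have key : ∀ b' < b, blockOf (ext s (finProdFinEquiv (b, i))
        (fun j => y ⟨j.1, j.2.trans (Fin.is_lt _)⟩)) b' = blockOf y b' := by
      intro b' hb'
      funext i'
      have hlt : finProdFinEquiv (b', i') < finProdFinEquiv (b, i) := by
        rw [Fin.lt_def, finProdFinEquiv_apply_val, finProdFinEquiv_apply_val]
        have h1 : b'.1 + 1 ≤ b.1 := hb'
        have h2 := i'.2
        simp only
        nlinarith
      simp only [blockOf, ext, dif_pos hlt]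
    rw [S.est_congr s.toRx _ y b (b.1 + 2 - S.order.pos s.1) le_rfl key,
      S.est_congr s.toRx _ y b (b.1 + 1 - S.order.pos s.1)
        (by change _ ≤ b.1 + 2 - S.order.pos s.1; omega) key]
  · intro y j h1 hB
    obtain ⟨j, rfl⟩ : ∃ k, j = k + 1 := ⟨j - 1, by omega⟩
    simp [msg, hB]

end TwoHopScheme

/-! ## The random codebook -/

/-- Two nested resamplings: averaging explicitly over the whole row `i₀` on both sides reduces the
claim to resampling the single entry `d₀` of that row. -/
theorem sum_pi_resample_curry {ι D α : Type*} [Fintype ι] [DecidableEq ι] [Fintype D]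
    [DecidableEq D] [Fintype α] (q : ι → α → ℝ) (hq : ∀ i, ∑ a, q i a = 1) (i₀ : ι) (d₀ : D)
    (G : (ι → D → α) → ℝ) :
    ∑ u : ι → D → α, (∏ i, ∏ d, q i (u i d)) * G u =
      ∑ u : ι → D → α, (∏ i, ∏ d, q i (u i d)) *
        ∑ a, q i₀ a * G (Function.update u i₀ (Function.update (u i₀) d₀ a)) := by
  have hQ : ∑ f : D → α, ∏ d, q i₀ (f d) = 1 := sum_pi_prod_eq_one (fun _ => q i₀) fun _ => hq i₀
  rw [← sum_pi_resample (fun i (f : D → α) => ∏ d, q i (f d)) i₀ hQ G,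
    ← sum_pi_resample (fun i (f : D → α) => ∏ d, q i (f d)) i₀ hQ (fun u => ∑ a, q i₀ a *
      G (Function.update u i₀ (Function.update (u i₀) d₀ a)))]
  refine Finset.sum_congr rfl fun u _ => ?_
  congr 1
  rw [← sum_pi_resample (fun _ : D => q i₀) d₀ (hq i₀) (fun f => G (Function.update u i₀ f))]
  simp only [Function.update_self, Function.update_idem]

theorem RelayOrder.pos_apply {T : ℕ} (π : RelayOrder T) (t : ℕ) : π.pos (π.1 t) = t :=
  π.1.symm_apply_apply t

theorem RelayOrder.apply_mem {T : ℕ} (π : RelayOrder T) {t : ℕ} (h1 : 1 ≤ t) (hT : t ≤ T - 1) :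
    π.1 t ∈ Finset.Icc 1 (T - 1) := by
  by_cases h : π.1 t ∈ Finset.Icc 2 (T - 1)
  · rw [Finset.mem_Icc] at h ⊢
    omega
  · have h2 := π.1.injective (π.2 _ h)
    rw [h2, Finset.mem_Icc]
    exact ⟨h1, hT⟩

namespace TwoHopInput

variable {T : ℕ} {X : Tx T → Type*} {Y : Rx T → Type*} [∀ s, Fintype (X s)]

/-- One symbol of all codewords of a block: the auxiliary codeword symbol for each sub-message,
and the channel input for each pair of sub-messages. -/
abbrev Column (p : TwoHopInput T X) (m : ℕ) : Type _ :=
  (Tx T → Fin m → Fin (p.k + 1)) × (∀ s, Fin m × Fin m → X s)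

variable {m : ℕ}

/-- The auxiliary symbols, inputs and outputs if the node at position `t` uses sub-message `V t`. -/
def transmitted (p : TwoHopInput T X) (π : RelayOrder T) (V : ℕ → Fin m)
    (z : p.Column m × ∀ s, Y s) : (Tx T → Fin (p.k + 1)) × (∀ s, X s) × (∀ s, Y s) :=
  (fun s => z.1.1 s (V (π.pos s.1)),
    fun s => z.1.2 s (V (π.pos s.1), V (π.pos s.1 + 1)), z.2)

/-- The value of the auxiliary symbol of the node at position `t`, for sub-message `v`. -/
def columnAux (p : TwoHopInput T X) (π : RelayOrder T) (c : p.Column m) (t : ℕ) (v : Fin m) :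
    Fin (p.k + 1) :=
  auxVal (fun s => c.1 s v) (π.1 t)

theorem auxVal_transmitted (p : TwoHopInput T X) (π : RelayOrder T) (V : ℕ → Fin m)
    (z : p.Column m × ∀ s, Y s) (t : ℕ) :
    auxVal (p.transmitted π V z).1 (π.1 t) = p.columnAux π z.1 t (V t) := by
  unfold auxVal columnAux auxVal
  split_ifs
  · simp only [transmitted, π.pos_apply]
  · rfl

variable [∀ s, Fintype (Y s)]

theorem joint_nonneg (p : TwoHopInput T X) (π : RelayOrder T) (ch : RelayChannel T X Y) (ω) :
    0 ≤ p.joint π ch ω :=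
  mul_nonneg (mul_nonneg (Finset.prod_nonneg fun s _ => (p.pU s).2.1 _)
    (Finset.prod_nonneg fun s _ => (p.pX s _ _).2.1 _)) ((ch _).2.1 _)

theorem sum_joint_mul (p : TwoHopInput T X) (π : RelayOrder T) (ch : RelayChannel T X Y)
    (g : (Tx T → Fin (p.k + 1)) × (∀ s, X s) × (∀ s, Y s) → ℝ) :
    ∑ ω, p.joint π ch ω * g ω = ∑ u : Tx T → Fin (p.k + 1), (∏ s, p.pU s (u s)) *
      ∑ x : ∀ s, X s, (∏ s : Tx T, p.pX s (u s) (auxVal u (π.1 (π.pos s.1 + 1))) (x s)) *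
        ∑ y, ch x y * g (u, x, y) := by
  rw [Fintype.sum_prod_type]
  refine Finset.sum_congr rfl fun u _ => ?_
  rw [Fintype.sum_prod_type, Finset.mul_sum]
  refine Finset.sum_congr rfl fun x _ => ?_
  rw [← mul_assoc, Finset.mul_sum]
  refine Finset.sum_congr rfl fun y _ => ?_
  simp only [joint]
  ring

theorem sum_joint_mul_fst (p : TwoHopInput T X) (π : RelayOrder T) (ch : RelayChannel T X Y)
    (g : (Tx T → Fin (p.k + 1)) → ℝ) :
    ∑ ω, p.joint π ch ω * g ω.1 =
      ∑ u : Tx T → Fin (p.k + 1), (∏ s, p.pU s (u s)) * g u := by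
  rw [sum_joint_mul]
  refine Finset.sum_congr rfl fun u _ => ?_
  congr 1
  have h1 : ∀ x : ∀ s, X s, ∑ y, ch x y * g u = g u := fun x => by
    rw [← Finset.sum_mul]
    exact (congrArg (· * g u) (ch x).2.2).trans (one_mul _)
  simp only [h1]
  rw [← Finset.sum_mul, sum_pi_prod_eq_one (fun s => p.pX s _ _) fun s => (p.pX s _ _).2.2, one_mul]

theorem sum_joint (p : TwoHopInput T X) (π : RelayOrder T) (ch : RelayChannel T X Y) :
    ∑ ω, p.joint π ch ω = 1 := by
  have := sum_joint_mul_fst p π ch (fun _ => 1)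
  simp only [mul_one] at this
  rw [this]
  exact sum_pi_prod_eq_one (fun s a => p.pU s a) fun s => (p.pU s).2.2

/-- The inputs and outputs sum out, leaving the product law of the auxiliary symbols, in which
coordinate `s₀` is independent of any function that ignores it. -/
theorem marg_joint_indep {γ : Type*} (p : TwoHopInput T X) (π : RelayOrder T)
    (ch : RelayChannel T X Y) (s₀ : Tx T) (C : (Tx T → Fin (p.k + 1)) → γ)
    (hC : ∀ u a, C (Function.update u s₀ a) = C u) (a : Fin (p.k + 1)) (c : γ) :
    marg (p.joint π ch) (fun ω => (ω.1 s₀, C ω.1)) (a, c) =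
      p.pU s₀ a * marg (p.joint π ch) (fun ω => C ω.1) c := by
  classical
  have h1 := sum_joint_mul_fst p π ch fun u => if u s₀ = a then (if C u = c then 1 else 0) else 0
  have h2 := sum_joint_mul_fst p π ch fun u => if C u = c then 1 else 0
  rw [sum_pi_indep (fun s a => p.pU s a) s₀ (p.pU s₀).2.2 (fun u => if C u = c then 1 else 0)
    (fun u a => by simp only [hC]) a, ← h2] at h1
  unfold marg
  simp only [mul_ite, mul_one, mul_zero] at h1
  rw [← h1]
  refine Finset.sum_congr rfl fun ω _ => ?_
  by_cases e1 : ω.1 s₀ = a <;> by_cases e2 : C ω.1 = c <;> simp [e1, e2]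

/-- The law of the input of node `s` for a pair of sub-messages, given the auxiliary symbols. -/
noncomputable def inputLaw (p : TwoHopInput T X) (π : RelayOrder T)
    (u : Tx T → Fin m → Fin (p.k + 1)) (s : Tx T) (d : Fin m × Fin m) : X s → ℝ :=
  p.pX s (u s d.1) (auxVal (fun s' => u s' d.2) (π.1 (π.pos s.1 + 1)))

/-- The probability of a column of the random codebook. -/
noncomputable def columnWeight (p : TwoHopInput T X) (π : RelayOrder T) (c : p.Column m) : ℝ :=
  (∏ s, ∏ v, p.pU s (c.1 s v)) * ∏ s, ∏ d, p.inputLaw π c.1 s d (c.2 s d)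

/-- The joint probability of a column of the codebook and of the channel outputs. -/
noncomputable def symbolWeight (p : TwoHopInput T X) (π : RelayOrder T) (ch : RelayChannel T X Y)
    (V : ℕ → Fin m) (z : p.Column m × ∀ s, Y s) : ℝ :=
  p.columnWeight π z.1 * ch (p.transmitted π V z).2.1 z.2

theorem columnWeight_nonneg (p : TwoHopInput T X) (π : RelayOrder T) (c : p.Column m) :
    0 ≤ p.columnWeight π c :=
  mul_nonneg (Finset.prod_nonneg fun _ _ => Finset.prod_nonneg fun _ _ => (p.pU _).2.1 _)
    (Finset.prod_nonneg fun _ _ => Finset.prod_nonneg fun _ _ => (p.pX _ _ _).2.1 _)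

theorem symbolWeight_nonneg (p : TwoHopInput T X) (π : RelayOrder T) (ch : RelayChannel T X Y)
    (V : ℕ → Fin m) (z : p.Column m × ∀ s, Y s) : 0 ≤ p.symbolWeight π ch V z :=
  mul_nonneg (p.columnWeight_nonneg π _) ((ch _).2.1 _)

/-- Every factor of the joint law at the transmitted triple occurs among the factors of the symbol
weight. This makes the logarithms of the likelihood ratios of the true sub-message meaningful. -/
theorem joint_transmitted_pos (p : TwoHopInput T X) (π : RelayOrder T) (ch : RelayChannel T X Y)
    (V : ℕ → Fin m) (z : p.Column m × ∀ s, Y s) (hz : p.symbolWeight π ch V z ≠ 0) :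
    0 < p.joint π ch (p.transmitted π V z) := by
  refine lt_of_le_of_ne (p.joint_nonneg π ch _) (Ne.symm ?_)
  unfold symbolWeight columnWeight at hz
  simp only [mul_ne_zero_iff, Finset.prod_ne_zero_iff, Finset.mem_univ, forall_true_left] at hz
  obtain ⟨⟨h1, h2⟩, h3⟩ := hz
  unfold joint
  simp only [mul_ne_zero_iff, Finset.prod_ne_zero_iff, Finset.mem_univ, forall_true_left]
  refine ⟨⟨fun s => h1 s _, fun s => ?_⟩, h3⟩
  have h := h2 s (V (π.pos s.1), V (π.pos s.1 + 1))
  unfold inputLaw at h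
  rw [auxVal_transmitted]
  exact h

/-- Averaging over the inputs and outputs for given auxiliary symbols. -/
theorem sum_symbolWeight_given (p : TwoHopInput T X) (π : RelayOrder T) (ch : RelayChannel T X Y)
    (V : ℕ → Fin m) (g : (Tx T → Fin m → Fin (p.k + 1)) → (∀ s, X s) → (∀ s, Y s) → ℝ) :
    ∑ z, p.symbolWeight π ch V z * g z.1.1 (p.transmitted π V z).2.1 z.2 =
      ∑ u : Tx T → Fin m → Fin (p.k + 1), (∏ s, ∏ v, p.pU s (u s v)) *
        ∑ x : ∀ s, X s, (∏ s : Tx T, p.pX s (u s (V (π.pos s.1)))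
          (auxVal (fun s => u s (V (π.pos s.1))) (π.1 (π.pos s.1 + 1))) (x s)) *
          ∑ y, ch x y * g u x y := by
  rw [Fintype.sum_prod_type, Fintype.sum_prod_type]
  refine Finset.sum_congr rfl fun u _ => ?_
  have h := sum_pi_eval (fun s (d : Fin m × Fin m) => p.inputLaw π u s d)
    (fun s d => (p.pX s _ _).2.2) (fun s => (V (π.pos s.1), V (π.pos s.1 + 1)))
    (fun x => ∑ y, ch x y * g u x y)
  have e : ∀ s : Tx T, p.inputLaw π u s (V (π.pos s.1), V (π.pos s.1 + 1)) =
      p.pX s (u s (V (π.pos s.1)))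
        (auxVal (fun s => u s (V (π.pos s.1))) (π.1 (π.pos s.1 + 1))) := by
    intro s
    unfold inputLaw auxVal
    split_ifs
    · simp only [π.pos_apply]
    · rfl
  simp only [e] at h
  rw [← h, Finset.mul_sum]
  refine Finset.sum_congr rfl fun x _ => ?_
  rw [← mul_assoc, Finset.mul_sum]
  refine Finset.sum_congr rfl fun y _ => ?_
  simp only [symbolWeight, columnWeight, transmitted]
  ring

/-- The auxiliary symbol of the next node that enters an input law is the one that this next node
itself uses. Hence the transmitted part of a random column has exactly the single-letter law
`joint`, whatever sub-messages are sent. -/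
theorem sum_symbolWeight_mul (p : TwoHopInput T X) (π : RelayOrder T) (ch : RelayChannel T X Y)
    (V : ℕ → Fin m) (g : (Tx T → Fin (p.k + 1)) × (∀ s, X s) × (∀ s, Y s) → ℝ) :
    ∑ z, p.symbolWeight π ch V z * g (p.transmitted π V z) = ∑ ω, p.joint π ch ω * g ω := by
  rw [sum_joint_mul]
  refine (p.sum_symbolWeight_given π ch V
    (fun u x y => g (fun s => u s (V (π.pos s.1)), x, y))).trans ?_
  exact sum_pi_eval (fun s (_ : Fin m) => p.pU s) (fun s _ => (p.pU s).2.2)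
    (fun s => V (π.pos s.1)) (fun u => ∑ x : ∀ s, X s,
      (∏ s : Tx T, p.pX s (u s) (auxVal u (π.1 (π.pos s.1 + 1))) (x s)) * ∑ y, ch x y * g (u, x, y))

theorem sum_symbolWeight (p : TwoHopInput T X) (π : RelayOrder T) (ch : RelayChannel T X Y)
    (V : ℕ → Fin m) : ∑ z, p.symbolWeight π ch V z = 1 := by
  have := p.sum_symbolWeight_mul π ch V (fun _ => 1)
  simpa only [mul_one, p.sum_joint π ch] using this

/-- The codeword symbols of the sub-messages that are not sent are independent of the others. -/
theorem sum_symbolWeight_mul_of_ne (p : TwoHopInput T X) (π : RelayOrder T)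
    (ch : RelayChannel T X Y) (V : ℕ → Fin m) (s₀ : Tx T) (v : Fin m) (hv : v ≠ V (π.pos s₀.1))
    (g : Fin (p.k + 1) → (Tx T → Fin (p.k + 1)) × (∀ s, X s) × (∀ s, Y s) → ℝ) :
    ∑ z, p.symbolWeight π ch V z * g (z.1.1 s₀ v) (p.transmitted π V z) =
      ∑ a, p.pU s₀ a * ∑ ω, p.joint π ch ω * g a ω := by
  refine (p.sum_symbolWeight_given π ch V
    (fun u x y => g (u s₀ v) (fun s => u s (V (π.pos s.1)), x, y))).trans ?_
  rw [sum_pi_resample_curry (fun s a => p.pU s a) (fun s => (p.pU s).2.2) s₀ v]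
  -- Resampling the entry `(s₀, v)` leaves all transmitted auxiliary symbols unchanged, because `s₀`
  -- does not send `v`.
  have e : ∀ (u : Tx T → Fin m → Fin (p.k + 1)) (a : Fin (p.k + 1)) (s : Tx T),
      Function.update u s₀ (Function.update (u s₀) v a) s (V (π.pos s.1)) =
        u s (V (π.pos s.1)) := by
    intro u a s
    by_cases hs : s = s₀
    · subst hs
      simp [hv.symm]
    · simp [hs]
  simp only [e, Function.update_self]
  simp only [Finset.mul_sum (Finset.univ : Finset (Fin (p.k + 1)))]
  rw [Finset.sum_comm]
  refine Finset.sum_congr rfl fun a _ => ?_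
  rw [sum_joint_mul, ← sum_pi_eval (fun s (_ : Fin m) => p.pU s) (fun s _ => (p.pU s).2.2)
    (fun s => V (π.pos s.1)), Finset.mul_sum]
  refine Finset.sum_congr rfl fun u _ => ?_
  rw [← mul_assoc, ← mul_assoc, mul_comm (p.pU s₀ a : ℝ)]

/-- The Markov ingredient for wrong candidates: the symbol of `v` at `s₀` is independent of what is
transmitted, and `hC` makes the side information independent of the true symbol of `s₀`. -/
theorem sum_symbolWeight_mul_infoRatio_le_one {γ : Type*} [Fintype γ] (p : TwoHopInput T X)
    (π : RelayOrder T) (ch : RelayChannel T X Y) (V : ℕ → Fin m) (s₀ : Tx T) (v : Fin m)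
    (hv : v ≠ V (π.pos s₀.1)) (s : Rx T) (C : (Tx T → Fin (p.k + 1)) → γ)
    (hC : ∀ u a, C (Function.update u s₀ a) = C u) :
    ∑ z, p.symbolWeight π ch V z * infoRatio (p.joint π ch) (fun ω => ω.1 s₀)
      (fun ω => ω.2.2 s) (fun ω => C ω.1) (z.1.1 s₀ v) (z.2 s) (C (p.transmitted π V z).1) ≤ 1 := by
  have h := p.sum_symbolWeight_mul_of_ne π ch V s₀ v hv (fun a ω => infoRatio (p.joint π ch)
    (fun ω => ω.1 s₀) (fun ω => ω.2.2 s) (fun ω => C ω.1) a (ω.2.2 s) (C ω.1))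
  refine le_of_eq_of_le h ?_
  exact sum_mul_infoRatio_le_one (p.joint_nonneg π ch) (p.sum_joint π ch) (fun ω => ω.1 s₀)
    (fun ω => ω.2.2 s) (fun ω => C ω.1) (fun a => p.pU s₀ a) (p.marg_joint_indep π ch s₀ C hC)

end TwoHopInput

/-! ## Error events on blocks -/

section Blocks

variable {ι Z : Type*} [Fintype ι] [DecidableEq ι] [Fintype Z]

/-- Symbols are independent, and both the weight and the test function depend only on the block;
each block therefore contributes an `n`-th power. -/
theorem sum_prod_blocks (n : ℕ) (W h : ι → Z → ℝ) :
    ∑ z : ι × Fin n → Z, (∏ τ, W τ.1 (z τ)) * ∏ τ, h τ.1 (z τ) =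
      ∏ b, (∑ a, W b a * h b a) ^ n := by
  simp_rw [← Finset.prod_mul_distrib]
  rw [← Fintype.prod_sum (fun (τ : ι × Fin n) a => W τ.1 a * h τ.1 a), Fintype.prod_prod_type]
  simp

theorem sum_prod_block (n : ℕ) (W : ι → Z → ℝ) (hW : ∀ b, ∑ a, W b a = 1) (b : ι) (h : Z → ℝ) :
    ∑ z : ι × Fin n → Z, (∏ τ, W τ.1 (z τ)) * ∏ i, h (z (b, i)) = (∑ a, W b a * h a) ^ n := by
  have e := sum_prod_blocks n W (fun b' a => if b' = b then h a else 1)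
  rw [Finset.prod_eq_single b] at e
  · simp only [if_true] at e
    rw [← e]
    refine Finset.sum_congr rfl fun z _ => ?_
    congr 1
    rw [Fintype.prod_prod_type, Finset.prod_eq_single b]
    · simp
    · intro b' _ hb
      simp [hb]
    · simp
  · intro b' _ hb
    simp [hb, hW]
  · simp

theorem sum_prod_two_blocks (n : ℕ) (W : ι → Z → ℝ) (hW : ∀ b, ∑ a, W b a = 1) {b b' : ι}
    (hb : b ≠ b') (h h' : Z → ℝ) :
    ∑ z : ι × Fin n → Z, (∏ τ, W τ.1 (z τ)) * ((∏ i, h (z (b, i))) * ∏ i, h' (z (b', i))) =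
      (∑ a, W b a * h a) ^ n * (∑ a, W b' a * h' a) ^ n := by
  have key : ∀ F : ι → ℝ, (∀ c, c ≠ b ∧ c ≠ b' → F c = 1) → ∏ c, F c = F b * F b' := fun F hF =>
    Finset.prod_eq_mul b b' hb (fun c _ hc => hF c hc) (by simp) (by simp)
  have e := sum_prod_blocks n W (fun c a => if c = b then h a else if c = b' then h' a else 1)
  rw [key] at e
  · simp only [if_true, if_neg hb.symm] at e
    rw [← e]
    refine Finset.sum_congr rfl fun z _ => ?_
    congr 1
    rw [Fintype.prod_prod_type, key]
    · simp only [if_true, if_neg hb.symm]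
    · rintro c ⟨h1, h2⟩
      simp [h1, h2]
  · rintro c ⟨h1, h2⟩
    simp [h1, h2, hW]

end Blocks

/-- Chernoff majorant for missing the true sub-message: on that event the exponential product is at
least one. -/
theorem one_le_prod_exp_of_prod_lt {n : ℕ} (r : Fin n → ℝ) (hr : ∀ i, 0 < r i) {l γ : ℝ}
    (hl : 0 < l) (h : ∏ i, r i < Real.exp (n * γ)) :
    1 ≤ ∏ i, Real.exp (-l * (Real.log (r i) - γ)) := by
  rw [← Real.exp_sum, ← Finset.mul_sum, Finset.sum_sub_distrib, ← Real.log_prod fun i _ => (hr i).ne']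
  have h1 := Real.log_lt_log (Finset.prod_pos fun i _ => hr i) h
  rw [Real.log_exp] at h1
  refine Real.one_le_exp ?_
  simp only [Finset.sum_const, Finset.card_univ, Fintype.card_fin, nsmul_eq_mul]
  nlinarith

/-- Markov majorant for a wrong candidate that passes the threshold. -/
theorem one_le_prod_mul_exp {n : ℕ} (r : Fin n → ℝ) {γ : ℝ} (h : Real.exp (n * γ) ≤ ∏ i, r i) :
    1 ≤ ∏ i, r i * Real.exp (-γ) := by
  rw [Finset.prod_mul_distrib, Finset.prod_const, Finset.card_univ, Fintype.card_fin,
    ← Real.exp_nat_mul]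
  calc (1 : ℝ) = Real.exp (n * γ) * Real.exp (n * -γ) := by
        rw [← Real.exp_add]; simp
    _ ≤ _ := mul_le_mul_of_nonneg_right h (Real.exp_pos _).le

theorem uniqueElem_eq {m : ℕ} {L : Finset (Fin m)} (d : Fin m) {v : Fin m} (hv : v ∈ L)
    (h : ∀ v' ∈ L, v' = v) : uniqueElem L d = v := by
  have hu : ∃! v, v ∈ L := ⟨v, hv, h⟩
  unfold uniqueElem
  rw [dif_pos hu]
  exact h _ hu.choose_spec.1

/-! ### The likelihood-ratio decoder and the splitting of its rate. -/

namespace TwoHopInput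

variable {T : ℕ} {X : Tx T → Type*} {Y : Rx T → Type*} [∀ s, Fintype (X s)] [∀ s, Fintype (Y s)]
  {m n B : ℕ}

/-- The auxiliary symbols of the nodes at the positions `t` and `t + 1`. -/
def ownAux {k : ℕ} (π : RelayOrder T) (t : ℕ) (u : Tx T → Fin (k + 1)) : Fin (k + 1) × Fin (k + 1) :=
  (auxVal u (π.1 t), auxVal u (π.1 (t + 1)))

/-- The likelihood ratio for the codeword of the node behind the receiver. -/
noncomputable def ratioCur (p : TwoHopInput T X) (π : RelayOrder T) (ch : RelayChannel T X Y)
    (s : Rx T) : Fin (p.k + 1) → Y s → Fin (p.k + 1) × Fin (p.k + 1) → ℝ :=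
  infoRatio (p.joint π ch) (fun ω => auxVal ω.1 (π.1 (π.pos s.1 - 1))) (fun ω => ω.2.2 s)
    (fun ω => ownAux π (π.pos s.1) ω.1)

/-- The likelihood ratio for the codeword of the node two positions behind the receiver. -/
noncomputable def ratioPrev (p : TwoHopInput T X) (π : RelayOrder T) (ch : RelayChannel T X Y)
    (s : Rx T) : Fin (p.k + 1) → Y s →
      Fin (p.k + 1) × Fin (p.k + 1) × Fin (p.k + 1) → ℝ :=
  infoRatio (p.joint π ch) (fun ω => auxVal ω.1 (π.1 (π.pos s.1 - 2))) (fun ω => ω.2.2 s)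
    (fun ω => (auxVal ω.1 (π.1 (π.pos s.1 - 1)), ownAux π (π.pos s.1) ω.1))

/-- The strategy that uses the codebook `C` and decodes by comparing likelihood ratios with the
thresholds `exp (n γ₁)` in the current and `exp (n γ₂)` in the previous block. -/
noncomputable def scheme (p : TwoHopInput T X) (π : RelayOrder T) (ch : RelayChannel T X Y)
    (γ₁ γ₂ : Rx T → ℝ) (d : Fin m) (C : Fin (B + T - 2) × Fin n → p.Column m) :
    TwoHopScheme T X Y m n B where
  order := π
  dummy := d
  enc s b v v' i := (C (b, i)).2 s (v, v')
  listPrev s b y v₁ v₂ v₃ :=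
    open Classical in Finset.univ.filter fun v => Real.exp (n * γ₂ s) ≤
      ∏ i, p.ratioPrev π ch s (p.columnAux π (C (b, i)) (π.pos s.1 - 2) v) (y i)
        (p.columnAux π (C (b, i)) (π.pos s.1 - 1) v₁, p.columnAux π (C (b, i)) (π.pos s.1) v₂,
          p.columnAux π (C (b, i)) (π.pos s.1 + 1) v₃)
  listCur s b y v₁ v₂ :=
    open Classical in Finset.univ.filter fun v => Real.exp (n * γ₁ s) ≤
      ∏ i, p.ratioCur π ch s (p.columnAux π (C (b, i)) (π.pos s.1 - 1) v) (y i)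
        (p.columnAux π (C (b, i)) (π.pos s.1) v₁, p.columnAux π (C (b, i)) (π.pos s.1 + 1) v₂)

theorem auxVal_update_of_ne {k : ℕ} (π : RelayOrder T) (s₀ : Tx T) (u : Tx T → Fin (k + 1))
    (a : Fin (k + 1)) {t : ℕ} (ht : t ≠ π.pos s₀.1) :
    auxVal (Function.update u s₀ a) (π.1 t) = auxVal u (π.1 t) := by
  unfold auxVal
  split_ifs with h
  · refine Function.update_of_ne (fun e => ht ?_) _ _
    rw [← e, π.pos_apply]
  · rfl

theorem auxVal_apply {k : ℕ} (u : Tx T → Fin (k + 1)) (s : Tx T) : auxVal u s.1 = u s :=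
  dif_pos s.2

theorem exists_tx (π : RelayOrder T) {t : ℕ} (h1 : 1 ≤ t) (hT : t ≤ T - 1) :
    ∃ s : Tx T, π.1 t = s.1 ∧ π.pos s.1 = t :=
  ⟨⟨π.1 t, π.apply_mem h1 hT⟩, rfl, π.pos_apply t⟩

theorem sum_symbolWeight_mul_ratioCur_le_one (p : TwoHopInput T X) (π : RelayOrder T)
    (ch : RelayChannel T X Y) (V : ℕ → Fin m) (s : Rx T) (v : Fin m)
    (hv : v ≠ V (π.pos s.1 - 1)) :
    ∑ z, p.symbolWeight π ch V z * p.ratioCur π ch s (p.columnAux π z.1 (π.pos s.1 - 1) v) (z.2 s)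
      (ownAux π (π.pos s.1) (p.transmitted π V z).1) ≤ 1 := by
  have ht := π.pos_mem s
  obtain ⟨s₀, h1, h2⟩ := exists_tx π (t := π.pos s.1 - 1) (by omega) (by omega)
  unfold ratioCur columnAux
  simp only [h1, auxVal_apply]
  refine p.sum_symbolWeight_mul_infoRatio_le_one π ch V s₀ v (h2 ▸ hv) s (ownAux π (π.pos s.1)) ?_
  intro u a
  unfold ownAux
  rw [auxVal_update_of_ne π s₀ u a (by omega), auxVal_update_of_ne π s₀ u a (by omega)]

theorem sum_symbolWeight_mul_ratioPrev_le_one (p : TwoHopInput T X) (π : RelayOrder T)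
    (ch : RelayChannel T X Y) (V : ℕ → Fin m) (s : Rx T) (hs : π.pos s.1 ≠ 2) (v : Fin m)
    (hv : v ≠ V (π.pos s.1 - 2)) :
    ∑ z, p.symbolWeight π ch V z * p.ratioPrev π ch s (p.columnAux π z.1 (π.pos s.1 - 2) v) (z.2 s)
      (auxVal (p.transmitted π V z).1 (π.1 (π.pos s.1 - 1)),
        ownAux π (π.pos s.1) (p.transmitted π V z).1) ≤ 1 := by
  have ht := π.pos_mem s
  obtain ⟨s₀, h1, h2⟩ := exists_tx π (t := π.pos s.1 - 2) (by omega) (by omega)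
  unfold ratioPrev columnAux
  simp only [h1, auxVal_apply]
  refine p.sum_symbolWeight_mul_infoRatio_le_one π ch V s₀ v (h2 ▸ hv) s
    (fun u => (auxVal u (π.1 (π.pos s.1 - 1)), ownAux π (π.pos s.1) u)) ?_
  intro u a
  unfold ownAux
  rw [auxVal_update_of_ne π s₀ u a (by omega), auxVal_update_of_ne π s₀ u a (by omega),
    auxVal_update_of_ne π s₀ u a (by omega)]

/-- The logarithm of the likelihood ratio of the transmitted codeword, current block. -/
noncomputable def densityCur (p : TwoHopInput T X) (π : RelayOrder T) (ch : RelayChannel T X Y)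
    (s : Rx T) (ω : (Tx T → Fin (p.k + 1)) × (∀ s, X s) × (∀ s, Y s)) : ℝ :=
  Real.log (p.ratioCur π ch s (auxVal ω.1 (π.1 (π.pos s.1 - 1))) (ω.2.2 s)
    (ownAux π (π.pos s.1) ω.1))

/-- The logarithm of the likelihood ratio of the transmitted codeword, previous block. -/
noncomputable def densityPrev (p : TwoHopInput T X) (π : RelayOrder T) (ch : RelayChannel T X Y)
    (s : Rx T) (ω : (Tx T → Fin (p.k + 1)) × (∀ s, X s) × (∀ s, Y s)) : ℝ :=
  Real.log (p.ratioPrev π ch s (auxVal ω.1 (π.1 (π.pos s.1 - 2))) (ω.2.2 s)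
    (auxVal ω.1 (π.1 (π.pos s.1 - 1)), ownAux π (π.pos s.1) ω.1))

theorem receptionRate_mul_log_two (p : TwoHopInput T X) (π : RelayOrder T)
    (ch : RelayChannel T X Y) (s : Rx T) :
    p.receptionRate π ch s * Real.log 2 =
      (∑ ω, p.joint π ch ω * p.densityCur π ch s ω) +
        ∑ ω, p.joint π ch ω * p.densityPrev π ch s ω :=
  condMutualInfo_chain (p.joint_nonneg π ch) (fun ω => auxVal ω.1 (π.1 (π.pos s.1 - 2)))
    (fun ω => auxVal ω.1 (π.1 (π.pos s.1 - 1))) (fun ω => ω.2.2 s)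
    (fun ω => ownAux π (π.pos s.1) ω.1)

/-- Position `0` is not a transmitter, so its auxiliary variable is constant and carries no
information. Thus position `2` loses nothing by using a single list. -/
theorem sum_densityPrev_eq_zero (p : TwoHopInput T X) (π : RelayOrder T)
    (ch : RelayChannel T X Y) (s : Rx T) (hs : π.pos s.1 = 2) :
    ∑ ω, p.joint π ch ω * p.densityPrev π ch s ω = 0 := by
  refine Finset.sum_eq_zero fun ω _ => ?_
  rcases (p.joint_nonneg π ch ω).eq_or_lt with h0 | h0
  · rw [← h0, zero_mul]
  · have e : ∀ u : Tx T → Fin (p.k + 1), auxVal u (π.1 (π.pos s.1 - 2)) = 0 := by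
      intro u
      rw [hs, π.2 _ (by simp), auxVal, dif_neg (by simp)]
    unfold densityPrev ratioPrev
    simp only [e]
    rw [infoRatio_const (p.joint_nonneg π ch) 0 (fun ω => ω.2.2 s)
      (fun ω => (auxVal ω.1 (π.1 (π.pos s.1 - 1)), ownAux π (π.pos s.1) ω.1)) h0]
    simp

end TwoHopInput

/-! ### The error probability of a single decoding step. -/

namespace TwoHopInput

variable {T : ℕ} {X : Tx T → Type*} {Y : Rx T → Type*} [∀ s, Fintype (X s)] [∀ s, Fintype (Y s)]
  {m n B : ℕ}

/-- The likelihood ratio of a candidate `v` in the current block, with correct side information. -/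
noncomputable def candCur (p : TwoHopInput T X) (π : RelayOrder T) (ch : RelayChannel T X Y)
    (V : ℕ → Fin m) (s : Rx T) (v : Fin m) (z : p.Column m × ∀ s, Y s) : ℝ :=
  p.ratioCur π ch s (p.columnAux π z.1 (π.pos s.1 - 1) v) (z.2 s)
    (ownAux π (π.pos s.1) (p.transmitted π V z).1)

/-- The likelihood ratio of a candidate `v` in the previous block, with correct side
information. -/
noncomputable def candPrev (p : TwoHopInput T X) (π : RelayOrder T) (ch : RelayChannel T X Y)
    (V : ℕ → Fin m) (s : Rx T) (v : Fin m) (z : p.Column m × ∀ s, Y s) : ℝ :=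
  p.ratioPrev π ch s (p.columnAux π z.1 (π.pos s.1 - 2) v) (z.2 s)
    (auxVal (p.transmitted π V z).1 (π.1 (π.pos s.1 - 1)),
      ownAux π (π.pos s.1) (p.transmitted π V z).1)

theorem candCur_nonneg (p : TwoHopInput T X) (π : RelayOrder T) (ch : RelayChannel T X Y)
    (V : ℕ → Fin m) (s : Rx T) (v : Fin m) (z : p.Column m × ∀ s, Y s) :
    0 ≤ p.candCur π ch V s v z :=
  infoRatio_nonneg (p.joint_nonneg π ch) _ _ _ _ _ _

theorem candPrev_nonneg (p : TwoHopInput T X) (π : RelayOrder T) (ch : RelayChannel T X Y)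
    (V : ℕ → Fin m) (s : Rx T) (v : Fin m) (z : p.Column m × ∀ s, Y s) :
    0 ≤ p.candPrev π ch V s v z :=
  infoRatio_nonneg (p.joint_nonneg π ch) _ _ _ _ _ _

theorem candCur_true (p : TwoHopInput T X) (π : RelayOrder T) (ch : RelayChannel T X Y)
    (V : ℕ → Fin m) (s : Rx T) (z : p.Column m × ∀ s, Y s)
    (hz : p.symbolWeight π ch V z ≠ 0) :
    0 < p.candCur π ch V s (V (π.pos s.1 - 1)) z ∧
      Real.log (p.candCur π ch V s (V (π.pos s.1 - 1)) z) =
        p.densityCur π ch s (p.transmitted π V z) := by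
  unfold candCur densityCur
  rw [← auxVal_transmitted]
  exact ⟨infoRatio_pos (p.joint_nonneg π ch) (fun ω => auxVal ω.1 (π.1 (π.pos s.1 - 1)))
    (fun ω => ω.2.2 s) (fun ω => ownAux π (π.pos s.1) ω.1) (p.joint_transmitted_pos π ch V z hz),
    rfl⟩

theorem candPrev_true (p : TwoHopInput T X) (π : RelayOrder T) (ch : RelayChannel T X Y)
    (V : ℕ → Fin m) (s : Rx T) (z : p.Column m × ∀ s, Y s)
    (hz : p.symbolWeight π ch V z ≠ 0) :
    0 < p.candPrev π ch V s (V (π.pos s.1 - 2)) z ∧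
      Real.log (p.candPrev π ch V s (V (π.pos s.1 - 2)) z) =
        p.densityPrev π ch s (p.transmitted π V z) := by
  unfold candPrev densityPrev
  rw [← auxVal_transmitted]
  exact ⟨infoRatio_pos (p.joint_nonneg π ch) (fun ω => auxVal ω.1 (π.1 (π.pos s.1 - 2)))
    (fun ω => ω.2.2 s)
    (fun ω => (auxVal ω.1 (π.1 (π.pos s.1 - 1)), ownAux π (π.pos s.1) ω.1))
    (p.joint_transmitted_pos π ch V z hz), rfl⟩

theorem mem_listCur (p : TwoHopInput T X) (π : RelayOrder T) (ch : RelayChannel T X Y)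
    (γ₁ γ₂ : Rx T → ℝ) (d : Fin m) (z : Fin (B + T - 2) × Fin n → p.Column m × ∀ s, Y s)
    (V : ℕ → Fin m) (s : Rx T) (b : Fin (B + T - 2)) (v v₁ v₂ : Fin m)
    (h₁ : V (π.pos s.1) = v₁) (h₂ : V (π.pos s.1 + 1) = v₂) :
    v ∈ (p.scheme π ch γ₁ γ₂ d fun τ => (z τ).1).listCur s b (fun i => (z (b, i)).2 s) v₁ v₂ ↔
      Real.exp (n * γ₁ s) ≤ ∏ i, p.candCur π ch V s v (z (b, i)) := by
  simp only [scheme, candCur, ownAux, auxVal_transmitted, h₁, h₂, Finset.mem_filter,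
    Finset.mem_univ, true_and]

theorem mem_listPrev (p : TwoHopInput T X) (π : RelayOrder T) (ch : RelayChannel T X Y)
    (γ₁ γ₂ : Rx T → ℝ) (d : Fin m) (z : Fin (B + T - 2) × Fin n → p.Column m × ∀ s, Y s)
    (V : ℕ → Fin m) (s : Rx T) (b : Fin (B + T - 2)) (v v₁ v₂ v₃ : Fin m)
    (h₁ : V (π.pos s.1 - 1) = v₁) (h₂ : V (π.pos s.1) = v₂) (h₃ : V (π.pos s.1 + 1) = v₃) :
    v ∈ (p.scheme π ch γ₁ γ₂ d fun τ => (z τ).1).listPrev s b (fun i => (z (b, i)).2 s)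
        v₁ v₂ v₃ ↔
      Real.exp (n * γ₂ s) ≤ ∏ i, p.candPrev π ch V s v (z (b, i)) := by
  simp only [scheme, candPrev, ownAux, auxVal_transmitted, h₁, h₂, h₃, Finset.mem_filter,
    Finset.mem_univ, true_and]

open Classical in
/-- The average over the random codebook of the probability that the receiver `s` decodes
`w_{j+1}` wrongly although its earlier estimates and all channel inputs are correct. -/
theorem sum_step_error_le (p : TwoHopInput T X) (π : RelayOrder T) (ch : RelayChannel T X Y)
    (γ₁ γ₂ : Rx T → ℝ) (d : Fin m) (V : ℕ → Fin m) (s : Rx T) {j : ℕ} (hj : j < B)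
    {l₁ l₂ : ℝ} (hl₁ : 0 < l₁) (hl₂ : 0 < l₂) :
    ∑ z : Fin (B + T - 2) × Fin n → p.Column m × ∀ s, Y s,
      (∏ τ, p.symbolWeight π ch (fun t => V (τ.1.1 + 2 - t)) (z τ)) *
        (if (p.scheme π ch γ₁ γ₂ d fun τ => (z τ).1).step s (fun b i => (z (b, i)).2 s) j
          (V j) (V (j - 1)) (V (j - 2)) ≠ V (j + 1) then 1 else 0) ≤
      (∑ ω, p.joint π ch ω * Real.exp (-l₁ * (p.densityCur π ch s ω - γ₁ s))) ^ n +
      (∑ ω, p.joint π ch ω * Real.exp (-l₂ * (p.densityPrev π ch s ω - γ₂ s))) ^ n +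
      m * Real.exp (-(n * (γ₁ s + if π.pos s.1 = 2 then 0 else γ₂ s))) := by
  have ht := π.pos_mem s
  -- In the block with zero-based index `b`, position `t` sends `w_{b+2-t}` afresh, together with
  -- its predecessor; truncation to `0` corresponds to the dummy.
  let W : Fin (B + T - 2) → (p.Column m × ∀ s, Y s) → ℝ :=
    fun b => p.symbolWeight π ch (fun t => V (b.1 + 2 - t))
  have hW0 : ∀ b a, 0 ≤ W b a := fun b a => p.symbolWeight_nonneg π ch _ a
  have hW1 : ∀ b, ∑ a, W b a = 1 := fun b => p.sum_symbolWeight π ch _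
  -- The blocks in which the positions `t - 1` and `t - 2` first send `w_{j+1}`. For `t = 2` the
  -- index of `b'` may truncate to that of `b`; this is harmless, since `F₂` is then just a
  -- superfluous nonnegative term.
  let b : Fin (B + T - 2) := ⟨j + π.pos s.1 - 2, by omega⟩
  let b' : Fin (B + T - 2) := ⟨j + π.pos s.1 - 3, by omega⟩
  let Vb : ℕ → Fin m := fun t => V (b.1 + 2 - t)
  let Vb' : ℕ → Fin m := fun t => V (b'.1 + 2 - t)
  have hV : ∀ q k, j + π.pos s.1 - 2 + 2 - q = k → Vb q = V k := fun q k h => congrArg V h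
  have hV' : ∀ q k, j + π.pos s.1 - 3 + 2 - q = k → Vb' q = V k := fun q k h => congrArg V h
  have c1 : Vb (π.pos s.1 - 1) = V (j + 1) := hV _ _ (by omega)
  have c2 : Vb (π.pos s.1) = V j := hV _ _ (by omega)
  have c3 : Vb (π.pos s.1 + 1) = V (j - 1) := hV _ _ (by omega)
  -- `F₁` and `F₂` dominate the events that the true sub-message is missing from a list, and `F₃ v`
  -- the event that `v` passes all tests used.
  let F₁ : (Fin (B + T - 2) × Fin n → p.Column m × ∀ s, Y s) → ℝ := fun z =>
    ∏ i, Real.exp (-l₁ * (p.densityCur π ch s (p.transmitted π Vb (z (b, i))) - γ₁ s))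
  let F₂ : (Fin (B + T - 2) × Fin n → p.Column m × ∀ s, Y s) → ℝ := fun z =>
    ∏ i, Real.exp (-l₂ * (p.densityPrev π ch s (p.transmitted π Vb' (z (b', i))) - γ₂ s))
  let G₁ : Fin m → (p.Column m × ∀ s, Y s) → ℝ := fun v a =>
    p.candCur π ch Vb s v a * Real.exp (-γ₁ s)
  let G₂ : Fin m → (p.Column m × ∀ s, Y s) → ℝ := fun v a =>
    p.candPrev π ch Vb' s v a * Real.exp (-γ₂ s)
  let F₃ : Fin m → (Fin (B + T - 2) × Fin n → p.Column m × ∀ s, Y s) → ℝ := fun v z =>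
    if π.pos s.1 = 2 then ∏ i, G₁ v (z (b, i))
    else (∏ i, G₁ v (z (b, i))) * ∏ i, G₂ v (z (b', i))
  have hG₁0 : ∀ v a, 0 ≤ G₁ v a := fun v a =>
    mul_nonneg (p.candCur_nonneg π ch _ _ _ _) (Real.exp_pos _).le
  have hG₂0 : ∀ v a, 0 ≤ G₂ v a := fun v a =>
    mul_nonneg (p.candPrev_nonneg π ch _ _ _ _) (Real.exp_pos _).le
  have hF₁0 : ∀ z, 0 ≤ F₁ z := fun z => Finset.prod_nonneg fun i _ => (Real.exp_pos _).le
  have hF₂0 : ∀ z, 0 ≤ F₂ z := fun z => Finset.prod_nonneg fun i _ => (Real.exp_pos _).le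
  have hF₃0 : ∀ v z, 0 ≤ F₃ v z := by
    intro v z
    have e1 : 0 ≤ ∏ i, G₁ v (z (b, i)) := Finset.prod_nonneg fun i _ => hG₁0 v _
    have e2 : 0 ≤ ∏ i, G₂ v (z (b', i)) := Finset.prod_nonneg fun i _ => hG₂0 v _
    by_cases h2 : π.pos s.1 = 2
    · simpa only [F₃, h2, if_true] using e1
    · simpa only [F₃, h2, if_false] using mul_nonneg e1 e2
  have hpt : ∀ z : Fin (B + T - 2) × Fin n → p.Column m × ∀ s, Y s,
      (∏ τ, W τ.1 (z τ)) *
        (if (p.scheme π ch γ₁ γ₂ d fun τ => (z τ).1).step s (fun b i => (z (b, i)).2 s) j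
          (V j) (V (j - 1)) (V (j - 2)) ≠ V (j + 1) then 1 else 0) ≤
      (∏ τ, W τ.1 (z τ)) * (F₁ z + F₂ z + ∑ v ∈ Finset.univ.erase (V (j + 1)), F₃ v z) := by
    intro z
    have hsum0 : 0 ≤ ∑ v ∈ Finset.univ.erase (V (j + 1)), F₃ v z :=
      Finset.sum_nonneg fun v _ => hF₃0 v z
    -- Outside the null set all likelihood ratios of the true sub-message are positive, with the
    -- densities as logarithms.
    by_cases hz : ∏ τ, W τ.1 (z τ) = 0
    · simp [hz]
    have hz' : ∀ τ, W τ.1 (z τ) ≠ 0 := fun τ => Finset.prod_ne_zero_iff.1 hz τ (Finset.mem_univ _)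
    refine mul_le_mul_of_nonneg_left ?_ (Finset.prod_nonneg fun τ _ => hW0 _ _)
    split_ifs with hne
    swap
    · linarith [hF₁0 z, hF₂0 z]
    -- If the majorant is below one, no bad event occurs, so the true sub-message is the unique
    -- survivor, contrary to `hne`.
    by_contra hlt
    have m1 : ∀ v, v ∈ (p.scheme π ch γ₁ γ₂ d fun τ => (z τ).1).listCur s b
        (fun i => (z (b, i)).2 s) (V j) (V (j - 1)) ↔ _ := fun v =>
      p.mem_listCur π ch γ₁ γ₂ d z Vb s b v _ _ c2 c3
    have a1 : V (j + 1) ∈ (p.scheme π ch γ₁ γ₂ d fun τ => (z τ).1).listCur s b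
        (fun i => (z (b, i)).2 s) (V j) (V (j - 1)) := by
      rw [m1]
      by_contra hc
      have h0 : ∀ i, 0 < p.candCur π ch Vb s (V (j + 1)) (z (b, i)) ∧ _ := fun i =>
        c1 ▸ p.candCur_true π ch Vb s (z (b, i)) (hz' (b, i))
      have := one_le_prod_exp_of_prod_lt _ (fun i => (h0 i).1) hl₁ (not_le.1 hc)
      simp only [fun i => (h0 i).2] at this
      linarith [hF₂0 z]
    refine hne ?_
    unfold TwoHopScheme.step
    rw [dif_pos hj]
    by_cases h2 : π.pos s.1 = 2
    · refine (if_pos h2).trans (uniqueElem_eq _ a1 fun v hv => ?_)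
      by_contra hvne
      have h1 := one_le_prod_mul_exp _ ((m1 v).1 hv)
      have h3 : 1 ≤ F₃ v z := by simpa only [F₃, h2, if_true] using h1
      have h4 := Finset.single_le_sum (fun v _ => hF₃0 v z)
        (Finset.mem_erase.2 ⟨hvne, Finset.mem_univ v⟩)
      linarith [hF₁0 z, hF₂0 z]
    · have c1' : Vb' (π.pos s.1 - 2) = V (j + 1) := hV' _ _ (by omega)
      have m2 : ∀ v, v ∈ (p.scheme π ch γ₁ γ₂ d fun τ => (z τ).1).listPrev s b'
          (fun i => (z (b', i)).2 s) (V j) (V (j - 1)) (V (j - 2)) ↔ _ := fun v =>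
        p.mem_listPrev π ch γ₁ γ₂ d z Vb' s b' v _ _ _ (hV' _ _ (by omega)) (hV' _ _ (by omega))
          (hV' _ _ (by omega))
      have a2 : V (j + 1) ∈ (p.scheme π ch γ₁ γ₂ d fun τ => (z τ).1).listPrev s b'
          (fun i => (z (b', i)).2 s) (V j) (V (j - 1)) (V (j - 2)) := by
        rw [m2]
        by_contra hc
        have h0 : ∀ i, 0 < p.candPrev π ch Vb' s (V (j + 1)) (z (b', i)) ∧ _ := fun i =>
          c1' ▸ p.candPrev_true π ch Vb' s (z (b', i)) (hz' (b', i))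
        have := one_le_prod_exp_of_prod_lt _ (fun i => (h0 i).1) hl₂ (not_le.1 hc)
        simp only [fun i => (h0 i).2] at this
        linarith [hF₁0 z]
      refine (if_neg h2).trans (uniqueElem_eq _ (Finset.mem_inter.2 ⟨a2, a1⟩) fun v hv => ?_)
      by_contra hvne
      have hv' := Finset.mem_inter.1 hv
      have h1 := one_le_prod_mul_exp _ ((m1 v).1 hv'.2)
      have h1' := one_le_prod_mul_exp _ ((m2 v).1 hv'.1)
      have h3 : 1 ≤ F₃ v z := by
        simpa only [F₃, h2, if_false] using one_le_mul_of_one_le_of_one_le h1 h1'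
      have h4 := Finset.single_le_sum (fun v _ => hF₃0 v z)
        (Finset.mem_erase.2 ⟨hvne, Finset.mem_univ v⟩)
      linarith [hF₁0 z, hF₂0 z]
  refine (Finset.sum_le_sum fun z _ => hpt z).trans ?_
  have hexp : ∀ z, (∏ τ, W τ.1 (z τ)) *
      (F₁ z + F₂ z + ∑ v ∈ Finset.univ.erase (V (j + 1)), F₃ v z) =
      (∏ τ, W τ.1 (z τ)) * F₁ z + (∏ τ, W τ.1 (z τ)) * F₂ z +
        ∑ v ∈ Finset.univ.erase (V (j + 1)), (∏ τ, W τ.1 (z τ)) * F₃ v z := fun z => by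
    rw [mul_add, mul_add, Finset.mul_sum]
  rw [Finset.sum_congr rfl fun z _ => hexp z, Finset.sum_add_distrib, Finset.sum_add_distrib]
  have s1 : ∑ z, (∏ τ, W τ.1 (z τ)) * F₁ z =
      (∑ ω, p.joint π ch ω * Real.exp (-l₁ * (p.densityCur π ch s ω - γ₁ s))) ^ n := by
    rw [← p.sum_symbolWeight_mul π ch Vb]
    exact sum_prod_block n W hW1 b fun a =>
      Real.exp (-l₁ * (p.densityCur π ch s (p.transmitted π Vb a) - γ₁ s))
  have s2 : ∑ z, (∏ τ, W τ.1 (z τ)) * F₂ z =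
      (∑ ω, p.joint π ch ω * Real.exp (-l₂ * (p.densityPrev π ch s ω - γ₂ s))) ^ n := by
    rw [← p.sum_symbolWeight_mul π ch Vb']
    exact sum_prod_block n W hW1 b' fun a =>
      Real.exp (-l₂ * (p.densityPrev π ch s (p.transmitted π Vb' a) - γ₂ s))
  rw [s1, s2]
  refine add_le_add le_rfl ?_
  rw [Finset.sum_comm]
  have s3 : ∀ v ∈ Finset.univ.erase (V (j + 1)), ∑ z, (∏ τ, W τ.1 (z τ)) * F₃ v z ≤
      Real.exp (-(n * (γ₁ s + if π.pos s.1 = 2 then 0 else γ₂ s))) := by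
    intro v hv
    have hv1 := Finset.ne_of_mem_erase hv
    have e1 : ∑ a, W b a * G₁ v a ≤ Real.exp (-γ₁ s) := by
      have h := p.sum_symbolWeight_mul_ratioCur_le_one π ch Vb s v (c1.symm ▸ hv1)
      simp only [G₁, ← mul_assoc]
      rw [← Finset.sum_mul]
      exact mul_le_of_le_one_left (Real.exp_pos _).le h
    have e1' := pow_le_pow_left₀ (Finset.sum_nonneg fun a _ => mul_nonneg (hW0 b a) (hG₁0 v a)) e1 n
    rw [← Real.exp_nat_mul] at e1'
    by_cases h2 : π.pos s.1 = 2
    · simp only [F₃, h2, if_true]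
      rw [sum_prod_block n W hW1 b (G₁ v)]
      simpa using e1'
    · have c1' : Vb' (π.pos s.1 - 2) = V (j + 1) := hV' _ _ (by omega)
      have e2 : ∑ a, W b' a * G₂ v a ≤ Real.exp (-γ₂ s) := by
        have h := p.sum_symbolWeight_mul_ratioPrev_le_one π ch Vb' s h2 v (c1'.symm ▸ hv1)
        simp only [G₂, ← mul_assoc]
        rw [← Finset.sum_mul]
        exact mul_le_of_le_one_left (Real.exp_pos _).le h
      have e2' := pow_le_pow_left₀
        (Finset.sum_nonneg fun a _ => mul_nonneg (hW0 b' a) (hG₂0 v a)) e2 n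
      rw [← Real.exp_nat_mul] at e2'
      -- For `t ≥ 3` no truncation occurs, so the two blocks differ and their expectations multiply.
      have hbb : b ≠ b' := by
        rw [Ne, Fin.ext_iff]
        change ¬ (j + π.pos s.1 - 2 = j + π.pos s.1 - 3)
        omega
      simp only [F₃, h2, if_false]
      rw [sum_prod_two_blocks n W hW1 hbb (G₁ v) (G₂ v)]
      refine (mul_le_mul e1' e2' (pow_nonneg (Finset.sum_nonneg fun a _ =>
        mul_nonneg (hW0 b' a) (hG₂0 v a)) n) (Real.exp_pos _).le).trans (le_of_eq ?_)
      rw [← Real.exp_add]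
      congr 1
      ring
  refine (Finset.sum_le_sum s3).trans ?_
  rw [Finset.sum_const, nsmul_eq_mul]
  refine mul_le_mul_of_nonneg_right ?_ (Real.exp_pos _).le
  have : (Finset.univ.erase (V (j + 1))).card ≤ m := by
    simpa only [Fintype.card_fin] using Finset.card_le_univ (Finset.univ.erase (V (j + 1)))
  exact_mod_cast this

end TwoHopInput

/-! ### From the random codebook to a fixed one. -/

/-- A nonnegative weighted average is attained or undercut somewhere. -/
theorem exists_le_of_sum_weight_mul_le {ι : Type*} [Fintype ι] (W Q : ι → ℝ) (hW : ∀ i, 0 ≤ W i)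
    (hW1 : ∑ i, W i = 1) {η : ℝ} (h : ∑ i, W i * Q i ≤ η) : ∃ i, Q i ≤ η := by
  by_contra! hc
  obtain ⟨i, -, hi⟩ : ∃ i ∈ Finset.univ, 0 < W i := by
    by_contra! h0
    have h1 : ∀ i, W i = 0 := fun i => le_antisymm (h0 i (Finset.mem_univ i)) (hW i)
    simp [h1] at hW1
  have h1 : ∑ i, W i * η < ∑ i, W i * Q i :=
    Finset.sum_lt_sum (fun i _ => mul_le_mul_of_nonneg_left (hc i).le (hW i))
      ⟨i, Finset.mem_univ i, mul_lt_mul_of_pos_left (hc i) hi⟩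
  rw [← Finset.sum_mul, hW1, one_mul] at h1
  exact absurd h (not_le.2 h1)

theorem stdSimplex.nonempty_index {ι : Type*} [Fintype ι] (f : stdSimplex ℝ ι) : Nonempty ι := by
  by_contra h
  rw [not_nonempty_iff] at h
  have := f.2.2
  simp at this

namespace TwoHopInput

variable {T : ℕ} {X : Tx T → Type*} {Y : Rx T → Type*} [∀ s, Fintype (X s)] [∀ s, Fintype (Y s)]
  {m n B : ℕ}

theorem sum_columnWeight (p : TwoHopInput T X) (π : RelayOrder T) :
    ∑ c : p.Column m, p.columnWeight π c = 1 := by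
  unfold columnWeight
  rw [Fintype.sum_prod_type]
  simp only [← Finset.mul_sum]
  have h : ∀ u : Tx T → Fin m → Fin (p.k + 1),
      ∑ x : ∀ s, Fin m × Fin m → X s, ∏ s, ∏ d, p.inputLaw π u s d (x s d) = 1 := fun u =>
    sum_pi_prod_eq_one (fun s (x : Fin m × Fin m → X s) => ∏ d, p.inputLaw π u s d (x d)) fun s =>
      sum_pi_prod_eq_one (fun d a => p.inputLaw π u s d a) fun d => (p.pX s _ _).2.2
  simp only [h, mul_one]
  exact sum_pi_prod_eq_one (fun s (f : Fin m → Fin (p.k + 1)) => ∏ v, p.pU s (f v)) fun s =>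
    sum_pi_prod_eq_one (fun _ a => p.pU s a) fun _ => (p.pU s).2.2

/-- This separates the codebook from the channel: with `V` the sub-messages of `w`, averaging the
idealized error over codebooks becomes a sum against `symbolWeight`. -/
theorem symbolWeight_eq_idealInput (p : TwoHopInput T X) (π : RelayOrder T)
    (ch : RelayChannel T X Y) (γ₁ γ₂ : Rx T → ℝ) (d : Fin m)
    (C : Fin (B + T - 2) × Fin n → p.Column m) (w : Fin (m ^ B)) (V : ℕ → Fin m)
    (hV : ∀ j, (p.scheme π ch γ₁ γ₂ d C).msg w j = V j) (τ : Fin (B + T - 2) × Fin n)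
    (y : ∀ s, Y s) :
    p.symbolWeight π ch (fun t => V (τ.1.1 + 2 - t)) (C τ, y) =
      p.columnWeight π (C τ) * ch ((p.scheme π ch γ₁ γ₂ d C).idealInput w τ) y := by
  unfold symbolWeight
  congr 3
  funext s
  simp only [transmitted, TwoHopScheme.idealInput, hV]
  have e : τ.1.1 + 2 - (π.pos s.1 + 1) = τ.1.1 + 1 - π.pos s.1 := by omega
  simp only [e]
  rfl

open Classical in
/-- Some realization of the random codebook is at least as good as the average. -/
theorem exists_codebook (p : TwoHopInput T X) (π : RelayOrder T) (ch : RelayChannel T X Y)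
    (γ₁ γ₂ : Rx T → ℝ) (d : Fin m) (n B : ℕ) {l₁ l₂ : Rx T → ℝ} (hl₁ : ∀ s, 0 < l₁ s)
    (hl₂ : ∀ s, 0 < l₂ s) :
    ∃ C : Fin (B + T - 2) × Fin n → p.Column m,
      (1 / ((m ^ B : ℕ) : ℝ)) * ∑ w : Fin (m ^ B), ∑ y : Fin (B + T - 2) × Fin n → ∀ s, Y s,
        (if ∃ s : Rx T, ∃ j < B, (p.scheme π ch γ₁ γ₂ d C).step s (fun b i => y (b, i) s) j
          ((p.scheme π ch γ₁ γ₂ d C).msg w j) ((p.scheme π ch γ₁ γ₂ d C).msg w (j - 1))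
          ((p.scheme π ch γ₁ γ₂ d C).msg w (j - 2)) ≠ (p.scheme π ch γ₁ γ₂ d C).msg w (j + 1)
        then ∏ τ, ch ((p.scheme π ch γ₁ γ₂ d C).idealInput w τ) (y τ) else 0) ≤
      ∑ s : Rx T, B *
        ((∑ ω, p.joint π ch ω * Real.exp (-l₁ s * (p.densityCur π ch s ω - γ₁ s))) ^ n +
        (∑ ω, p.joint π ch ω * Real.exp (-l₂ s * (p.densityPrev π ch s ω - γ₂ s))) ^ n +
        m * Real.exp (-(n * (γ₁ s + if π.pos s.1 = 2 then 0 else γ₂ s)))) := by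
  let E : Rx T → ℝ := fun s =>
    (∑ ω, p.joint π ch ω * Real.exp (-l₁ s * (p.densityCur π ch s ω - γ₁ s))) ^ n +
    (∑ ω, p.joint π ch ω * Real.exp (-l₂ s * (p.densityPrev π ch s ω - γ₂ s))) ^ n +
    m * Real.exp (-(n * (γ₁ s + if π.pos s.1 = 2 then 0 else γ₂ s)))
  let V : Fin (m ^ B) → ℕ → Fin m := fun w j =>
    if h : 1 ≤ j ∧ j ≤ B then (finFunctionFinEquiv.symm w : Fin B → Fin m) ⟨j - 1, by omega⟩ else d
  have hV : ∀ C w j, (p.scheme (n := n) π ch γ₁ γ₂ d C).msg w j = V w j := fun _ _ _ => rfl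
  refine exists_le_of_sum_weight_mul_le
    (fun C : Fin (B + T - 2) × Fin n → p.Column m => ∏ τ, p.columnWeight π (C τ)) _
    (fun C => Finset.prod_nonneg fun τ _ => p.columnWeight_nonneg π _)
    (sum_pi_prod_eq_one (fun _ => p.columnWeight π) fun _ => p.sum_columnWeight π) ?_
  have hM : (0 : ℝ) < ((m ^ B : ℕ) : ℝ) := by
    have : 0 < m := d.pos
    positivity
  have hw : ∀ w : Fin (m ^ B), ∑ C : Fin (B + T - 2) × Fin n → p.Column m,
      ∑ y : Fin (B + T - 2) × Fin n → ∀ s, Y s, (∏ τ, p.columnWeight π (C τ)) *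
        (if ∃ s : Rx T, ∃ j < B, (p.scheme π ch γ₁ γ₂ d C).step s (fun b i => y (b, i) s) j
          (V w j) (V w (j - 1)) (V w (j - 2)) ≠ V w (j + 1)
        then ∏ τ, ch ((p.scheme π ch γ₁ γ₂ d C).idealInput w τ) (y τ) else 0) ≤
      ∑ s, B * E s := by
    intro w
    let e := Equiv.arrowProdEquivProdArrow (Fin (B + T - 2) × Fin n) (fun _ => p.Column m)
      (fun _ => ∀ s, Y s)
    -- Codebook and outputs are merged into one column-output pair per symbol; the rest is a union
    -- bound over receivers and sub-messages.
    rw [← Fintype.sum_prod_type', ← e.sum_comp]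
    have hs : ∀ s : Rx T, (B : ℝ) * E s = ∑ _j : Fin B, E s := fun s => by simp
    simp only [hs]
    refine le_trans ?_ (Finset.sum_le_sum fun s _ => Finset.sum_le_sum fun j _ =>
      p.sum_step_error_le π ch γ₁ γ₂ d (V w) s j.2 (hl₁ s) (hl₂ s))
    rw [Finset.sum_congr rfl fun s _ => Finset.sum_comm, Finset.sum_comm]
    refine Finset.sum_le_sum fun z _ => ?_
    simp only [← Finset.mul_sum]
    have hWz : ∏ τ, p.symbolWeight π ch (fun t => V w (τ.1.1 + 2 - t)) (z τ) =
        (∏ τ, p.columnWeight π (z τ).1) *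
          ∏ τ, ch ((p.scheme π ch γ₁ γ₂ d fun τ => (z τ).1).idealInput w τ) (z τ).2 := by
      rw [← Finset.prod_mul_distrib]
      exact Finset.prod_congr rfl fun τ _ =>
        p.symbolWeight_eq_idealInput π ch γ₁ γ₂ d (fun τ => (z τ).1) w (V w) (hV _ w) τ (z τ).2
    have hW0 : 0 ≤ ∏ τ, p.symbolWeight π ch (fun t => V w (τ.1.1 + 2 - t)) (z τ) :=
      Finset.prod_nonneg fun τ _ => p.symbolWeight_nonneg π ch _ _
    have hnn : ∀ s : Rx T, ∀ j : Fin B, (0 : ℝ) ≤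
        if (p.scheme π ch γ₁ γ₂ d fun τ => (z τ).1).step s (fun b i => (z (b, i)).2 s) j
          (V w j) (V w (j - 1)) (V w (j - 2)) ≠ V w (j + 1) then 1 else 0 := fun s j => by
      split_ifs <;> simp
    rw [mul_ite, mul_zero]
    change (if ∃ s : Rx T, ∃ j < B, (p.scheme π ch γ₁ γ₂ d fun τ => (z τ).1).step s
      (fun b i => (z (b, i)).2 s) j (V w j) (V w (j - 1)) (V w (j - 2)) ≠ V w (j + 1)
      then (∏ τ, p.columnWeight π (z τ).1) *
        ∏ τ, ch ((p.scheme π ch γ₁ γ₂ d fun τ => (z τ).1).idealInput w τ) (z τ).2 else 0) ≤ _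
    rw [← hWz]
    split_ifs with hex
    · obtain ⟨s, j, hj, hne⟩ := hex
      refine le_mul_of_one_le_right hW0 ?_
      have h2 := Finset.single_le_sum (fun j _ => hnn s j) (Finset.mem_univ (⟨j, hj⟩ : Fin B))
      rw [if_pos hne] at h2
      refine h2.trans (Finset.single_le_sum (f := fun s => ∑ j : Fin B, _) (fun s _ =>
        Finset.sum_nonneg fun j _ => hnn s j) (Finset.mem_univ s))
    · exact mul_nonneg hW0 (Finset.sum_nonneg fun s _ => Finset.sum_nonneg fun j _ => hnn s j)
  have hswap : ∀ F : (Fin (B + T - 2) × Fin n → p.Column m) → Fin (m ^ B) →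
      (Fin (B + T - 2) × Fin n → ∀ s, Y s) → ℝ,
      ∑ C, (∏ τ, p.columnWeight π (C τ)) * ((1 / ((m ^ B : ℕ) : ℝ)) * ∑ w, ∑ y, F C w y) =
        (1 / ((m ^ B : ℕ) : ℝ)) * ∑ w, ∑ C, ∑ y, (∏ τ, p.columnWeight π (C τ)) * F C w y := by
    intro F
    rw [Finset.sum_comm, Finset.mul_sum]
    refine Finset.sum_congr rfl fun C _ => ?_
    simp only [← Finset.mul_sum]
    ring
  -- The bound for a fixed message does not depend on the message, so it survives the uniform
  -- average.
  refine (hswap _).trans_le ?_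
  refine (mul_le_mul_of_nonneg_left (Finset.sum_le_sum fun w _ => hw w)
    (by positivity)).trans (le_of_eq ?_)
  rw [Finset.sum_const, Finset.card_univ, Fintype.card_fin, nsmul_eq_mul, one_div,
    inv_mul_cancel_left₀ hM.ne']

end TwoHopInput

/-! ### Choice of the parameters and conclusion. -/

/-- A code with a single message. -/
theorem exists_trivial_code {T : ℕ} (hT : 2 ≤ T) {X : Tx T → Type*} {Y : Rx T → Type*}
    [∀ s, Nonempty (X s)] [∀ s, Nonempty (Y s)] [∀ s, Fintype (Y s)] (ch : RelayChannel T X Y)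
    (π : RelayOrder T) :
    ∃ (S : TwoHopScheme T X Y 1 1 1) (c : RelayCode T hT X Y (1 ^ 1) ((1 + T - 2) * 1)),
      S.Implements c ∧ c.rate = 0 ∧ S.nodeErrorProb ch c = 0 := by
  let S : TwoHopScheme T X Y 1 1 1 :=
    { order := π
      dummy := 0
      enc := fun s _ _ _ _ => Classical.arbitrary (X s)
      listPrev := fun _ _ _ _ _ _ => ∅
      listCur := fun _ _ _ _ _ => ∅ }
  obtain ⟨c, hc⟩ := S.exists_implements hT
  refine ⟨S, c, hc, by simp [RelayCode.rate], ?_⟩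
  have h : ∀ (w : Fin (1 ^ 1)) (y : Fin ((1 + T - 2) * 1) → ∀ s, Y s), ¬ ∃ (s : Rx T) (j : ℕ),
      1 ≤ j ∧ j ≤ 1 ∧ S.est s (fun i => y i s) j ≠ S.msg w j := by
    rintro w y ⟨s, j, -, -, hne⟩
    exact hne (Subsingleton.elim _ _)
  simp [TwoHopScheme.nodeErrorProb, RelayCode.prob, h]

/-- The parameters of the decoder of one receiver: thresholds and exponents. -/
theorem TwoHopInput.exists_exponents {T : ℕ} {X : Tx T → Type*} {Y : Rx T → Type*}
    [∀ s, Fintype (X s)] [∀ s, Fintype (Y s)] (p : TwoHopInput T X) (π : RelayOrder T)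
    (ch : RelayChannel T X Y) (s : Rx T) {r : ℝ} (hr : r < p.receptionRate π ch s) :
    ∃ γ₁ γ₂ l₁ l₂ : ℝ, 0 < l₁ ∧ 0 < l₂ ∧
      ∑ ω, p.joint π ch ω * Real.exp (-l₁ * (p.densityCur π ch s ω - γ₁)) < 1 ∧
      ∑ ω, p.joint π ch ω * Real.exp (-l₂ * (p.densityPrev π ch s ω - γ₂)) < 1 ∧
      r * Real.log 2 < γ₁ + if π.pos s.1 = 2 then 0 else γ₂ := by
  have h2 : 0 < Real.log 2 := Real.log_pos one_lt_two
  have hrate := p.receptionRate_mul_log_two π ch s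
  set E₁ := ∑ ω, p.joint π ch ω * p.densityCur π ch s ω with hE₁
  set E₂ := ∑ ω, p.joint π ch ω * p.densityPrev π ch s ω with hE₂
  have hlt := mul_lt_mul_of_pos_right hr h2
  -- Each threshold is set `η` below its mean; a quarter of the rate gap leaves room for both
  -- reductions.
  obtain ⟨η, hη, hη2⟩ : ∃ η : ℝ, 0 < η ∧ r * Real.log 2 < E₁ + E₂ - 2 * η :=
    ⟨(E₁ + E₂ - r * Real.log 2) / 4, by linarith, by linarith⟩
  have hmean : ∀ (f : _ → ℝ) (e : ℝ), ∑ ω, p.joint π ch ω * f ω = e →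
      0 < ∑ ω, p.joint π ch ω * (f ω - (e - η)) := by
    intro f e he
    simp only [mul_sub, Finset.sum_sub_distrib, he, ← Finset.sum_mul, p.sum_joint π ch]
    linarith
  obtain ⟨l₁, hl₁, h₁⟩ := exists_sum_exp_lt_one _ _ (p.sum_joint π ch) (hmean _ _ hE₁.symm)
  obtain ⟨l₂, hl₂, h₂⟩ := exists_sum_exp_lt_one _ _ (p.sum_joint π ch) (hmean _ _ hE₂.symm)
  refine ⟨E₁ - η, E₂ - η, l₁, l₂, hl₁, hl₂, h₁, h₂, ?_⟩
  split_ifs with hs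
  · have := p.sum_densityPrev_eq_zero π ch s hs
    linarith
  · linarith

theorem theorem2 (T : ℕ) (hT : 2 ≤ T) (X : Tx T → Type*) (Y : Rx T → Type*)
    [∀ s, Fintype (X s)] [∀ s, Fintype (Y s)] (ch : RelayChannel T X Y)
    (R : ℝ) (hR : (R : EReal) ≤ twoHopRate ch) :
    TwoHopAchievable hT ch R := by
  intro δ hδ ε hε
  have hlt : ((R - δ / 2 : ℝ) : EReal) < twoHopRate ch :=
    lt_of_lt_of_le (EReal.coe_lt_coe_iff.2 (by linarith)) hR
  unfold twoHopRate at hlt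
  obtain ⟨π, hlt⟩ := lt_iSup_iff.1 hlt
  obtain ⟨p, hlt⟩ := lt_iSup_iff.1 hlt
  set r : ℝ := R - δ / 2 with hr
  have hrate : ∀ s, r < p.receptionRate π ch s := fun s =>
    EReal.coe_lt_coe_iff.1 (lt_of_lt_of_le hlt (iInf_le _ s))
  have hX : ∀ s, Nonempty (X s) := fun s => stdSimplex.nonempty_index (p.pX s 0 0)
  have hY : Nonempty (∀ s, Y s) := stdSimplex.nonempty_index (ch fun s => Classical.arbitrary _)
  have hY' : ∀ s, Nonempty (Y s) := fun s => hY.map fun y => y s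
  -- For `r ≤ 0` a rate-zero code suffices; positivity of `r` is used below in rounding `m` and in
  -- bounding the rate loss.
  rcases le_or_gt r 0 with hr0 | hr0
  · obtain ⟨S, c, hc, hc0, he⟩ := exists_trivial_code hT ch π
    refine ⟨1, 1, 1, S, c, le_rfl, le_rfl, hc, ?_, ?_, ?_⟩
    · rw [hc0]
      linarith
    · exact (TwoHopScheme.errorProb_le_nodeErrorProb ch hc).trans_lt (he.trans_lt hε)
    · exact he.trans_lt hε
  choose γ₁ γ₂ l₁ l₂ hl₁ hl₂ h₁ h₂ hγ using fun s => p.exists_exponents π ch s (hrate s)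
  have hlog : 0 < Real.log 2 := Real.log_pos one_lt_two
  -- With this many sub-messages `r * T ≤ B * δ / 2`, so the factor `B / (B + T - 2)` costs at most
  -- `δ / 2` of the rate.
  obtain ⟨B₀, hB₀⟩ := exists_nat_ge (r * T * 2 / δ)
  set B : ℕ := B₀ + 1 with hB
  -- the number of sub-message values for block length `n`
  let m : ℕ → ℕ := fun n => ⌈Real.exp (n * (r * Real.log 2))⌉₊
  have hm : ∀ n : ℕ, Real.exp (n * (r * Real.log 2)) ≤ m n := fun n => Nat.le_ceil _
  have hm0 : ∀ n : ℕ, 0 < m n := fun n => Nat.ceil_pos.2 (Real.exp_pos _)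
  have hm2 : ∀ n : ℕ, (m n : ℝ) ≤ 2 * Real.exp (n * (r * Real.log 2)) := by
    intro n
    have h1 : (m n : ℝ) < Real.exp (n * (r * Real.log 2)) + 1 :=
      Nat.ceil_lt_add_one (Real.exp_pos _).le
    have h2 : 1 ≤ Real.exp (n * (r * Real.log 2)) := Real.one_le_exp (by positivity)
    linarith
  set c₁ : Rx T → ℝ := fun s =>
    ∑ ω, p.joint π ch ω * Real.exp (-l₁ s * (p.densityCur π ch s ω - γ₁ s))
  set c₂ : Rx T → ℝ := fun s =>
    ∑ ω, p.joint π ch ω * Real.exp (-l₂ s * (p.densityPrev π ch s ω - γ₂ s))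
  let γ : Rx T → ℝ := fun s => γ₁ s + if π.pos s.1 = 2 then 0 else γ₂ s
  have hc₁0 : ∀ s, 0 ≤ c₁ s := fun s => Finset.sum_nonneg fun ω _ =>
    mul_nonneg (p.joint_nonneg π ch ω) (Real.exp_pos _).le
  have hc₂0 : ∀ s, 0 ≤ c₂ s := fun s => Finset.sum_nonneg fun ω _ =>
    mul_nonneg (p.joint_nonneg π ch ω) (Real.exp_pos _).le
  -- `B` is already fixed, so finitely many geometric sequences with ratio below one remain; the
  -- factor `2` pays for rounding up `m n`.
  have hlim : Filter.Tendsto (fun n : ℕ => ∑ s : Rx T, (B : ℝ) *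
      (c₁ s ^ n + c₂ s ^ n + 2 * Real.exp (r * Real.log 2 - γ s) ^ n)) Filter.atTop (nhds 0) := by
    have : ∀ s : Rx T, Filter.Tendsto (fun n : ℕ => (B : ℝ) *
        (c₁ s ^ n + c₂ s ^ n + 2 * Real.exp (r * Real.log 2 - γ s) ^ n)) Filter.atTop
        (nhds (B * (0 + 0 + 2 * 0))) := fun s =>
      (((tendsto_pow_atTop_nhds_zero_of_lt_one (hc₁0 s) (h₁ s)).add
        (tendsto_pow_atTop_nhds_zero_of_lt_one (hc₂0 s) (h₂ s))).add
        ((tendsto_pow_atTop_nhds_zero_of_lt_one (Real.exp_pos _).le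
          (Real.exp_lt_one_iff.2 (by linarith [hγ s]))).const_mul 2)).const_mul _
    simpa using tendsto_finsetSum Finset.univ fun s _ => this s
  obtain ⟨n, hn, hn1⟩ := ((hlim.eventually (gt_mem_nhds hε)).and
    (Filter.eventually_ge_atTop 1)).exists
  obtain ⟨C, hC⟩ := p.exists_codebook π ch γ₁ γ₂ (⟨0, hm0 n⟩ : Fin (m n)) n B hl₁ hl₂
  set S := p.scheme π ch γ₁ γ₂ (⟨0, hm0 n⟩ : Fin (m n)) C
  obtain ⟨c, hc⟩ := S.exists_implements hT
  have herr : S.nodeErrorProb ch c < ε := by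
    refine (TwoHopScheme.nodeErrorProb_le ch hc).trans_lt (lt_of_le_of_lt hC
      (lt_of_le_of_lt (Finset.sum_le_sum fun s _ => ?_) hn))
    refine mul_le_mul_of_nonneg_left (add_le_add le_rfl ?_) (Nat.cast_nonneg _)
    refine (mul_le_mul_of_nonneg_right (hm2 n) (Real.exp_pos _).le).trans (le_of_eq ?_)
    rw [mul_assoc, ← Real.exp_add, ← Real.exp_nat_mul]
    congr 2
    ring
  refine ⟨m n, n, B, S, c, hn1, by omega, hc, ?_,
    (TwoHopScheme.errorProb_le_nodeErrorProb ch hc).trans_lt herr, herr⟩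
  have hn0 : (0 : ℝ) < n := by exact_mod_cast hn1
  have hBT : ((B + T - 2 : ℕ) : ℝ) = B + T - 2 := by
    rw [Nat.cast_sub (by omega)]
    push_cast
    ring
  have hT' : (2 : ℝ) ≤ T := by exact_mod_cast hT
  have hB1 : r * T * 2 / δ ≤ B := by
    rw [hB]
    push_cast
    linarith
  have hBpos : (0 : ℝ) < B := by
    rw [hB]
    positivity
  have hlogm : n * r ≤ Real.logb 2 (m n) := by
    rw [Real.logb, le_div_iff₀ hlog, mul_assoc]
    exact (Real.le_log_iff_exp_le (by exact_mod_cast hm0 n)).2 (hm n)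
  unfold RelayCode.rate
  push_cast
  rw [hBT, Real.logb_pow, le_div_iff₀ (mul_pos (by linarith) hn0)]
  have h3 : (R - δ) * (B + T - 2) ≤ B * r := by
    rw [div_le_iff₀ hδ] at hB1
    have e : R - δ = r - δ / 2 := by rw [hr]; ring
    rw [e]
    nlinarith
  calc (R - δ) * ((B + T - 2) * n) = (R - δ) * (B + T - 2) * n := by ring
    _ ≤ B * r * n := mul_le_mul_of_nonneg_right h3 hn0.le
    _ = B * (n * r) := by ring
    _ ≤ B * Real.logb 2 (m n) := mul_le_mul_of_nonneg_left hlogm hBpos.le
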